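/- **Setting.** Let $d\in\mathbb N$ and $T\in(0,\infty]$, and put $\mathcal O_T=(0,T)\times\mathbb R^d$. For $X=(t,x)$ and $Y=(s,y)$ in $\mathbb R\times\mathbb R^d$ let $\delta(X,Y)=\max\{|x-y|,|t-s|^{1/2}\}$ and $Q_\rho(X)=\{Y:\delta(X,Y)<\rho\}$. Write $|\cdot|$ for Lebesgue measure of sets and $\operatorname{diam}$ for the diameter with respect to $\delta$. A bounded domain $D\subset\mathbb R^{d+1}$ is of $A$-type, with constant $A>0$, if $|D\cap Q_\rho(X)|\ge A\,|Q_\rho(X)|$ for all $X\in D$ and $0<\rho\le\operatorname{diam}D$. For $p\ge1$, $\theta\ge0$ and a measurable random field $h$, put $$[h]^p_{\mathscr L^{p,\theta}((D;\delta);L^p(\Omega))}=\sup_{X\in D,\ 0<\rho\le \operatorname{diam}D}\frac1{|Q|^{1+\theta}}\,\mathbb E\int_Q\int_Q|h(Y)-h(Z)|^p\,dZ\,dY,\qquad Q=D\cap Q_\rho(X).$$ Let $W$ be a one-dimensional Brownian motion. For a (non-random) measurable kernel $K:\mathbb R\times\mathbb R^d\to\mathbb R$ and a (non-random) $g:\mathbb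 R^d\to\mathbb R$, set $$\mathcal Kg(t,x)=\int_0^t\int_{\mathbb R^d}K(t-r,y)\,g(x-y)\,dy\,dW(r).$$ **Theorem.** Let $0<\beta<1$ and let $g\in C^\beta$ be independent of time with $g(0)=0$, i.e. $|g(x)-g(y)|\le C_g|x-y|^\beta$ for all $x,y\in\mathbb R^d$. Assume that there are $\gamma_1,\gamma_2>0$ and constants $N_0,N_1\ge 0$ such that for all $0\le s<t\le T$, $t<\infty$, $$\int_0^s\Big(\int_{\mathbb R^d}|K(t-r,z)-K(s-r,z)|(1+|z|^\beta)\,dz\Big)^2dr\le N_1(t-s)^{\gamma_1},$$ $$\int_0^s\Big(\int_{\mathbb R^d}|K(s-r,z)|\,dz\Big)^2dr\le N_0,$$ $$\int_s^t\Big(\int_{\mathbb R^d}|K(t-r,z)|(1+|z|^\beta)\,dz\Big)^2dr\le N_1(t-s)^{\gamma_2}.$$ Then $\mathcal Kg$ is well defined on $\mathcal O_T$ and has a jointly measurable version there. Moreover, let $D$ be an $A$-type bounded domain with constant $A$, with $\overline D\subset\mathcal O_T$ and $|t|\le R$, $|x|\le R$ for all $(t,x)\in D$. Then for every $p\ge1$,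 with $\gamma=\min\{\gamma_1,\gamma_2,\beta\}$ and $\theta=1+\frac{\gamma p}{d+2}$, every jointly measurable version of $\mathcal Kg$ satisfies $$[\mathcal Kg]_{\mathscr L^{p,\theta}((D;\delta);L^p(\Omega))}\le N,$$ where the finite constant $N$ depends only on $d,T,p,\beta,\gamma_1,\gamma_2,N_0,N_1,C_g,A,R$. -/

import Mathlib

open MeasureTheory ProbabilityTheory Set Filter Topology
open scoped ENNReal NNReal

noncomputable section

/-- Space-time `ℝ × ℝ^d`; a point is `X = (t, x)`. -/
abbrev SpaceTime (d : ℕ) : Type := ℝ × EuclideanSpace ℝ (Fin d)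

/-- The parabolic distance `δ(X, Y) = max {|x - y|, |t - s|^{1/2}}`. -/
def parabolicDist {d : ℕ} (X Y : SpaceTime d) : ℝ :=
  max ‖X.2 - Y.2‖ (|X.1 - Y.1| ^ (1 / 2 : ℝ))

/-- The parabolic ball `Q_c(X)`, that is `(t - c², t + c²) × B_c(x)` for `c > 0`. -/
def parabolicBall {d : ℕ} (X : SpaceTime d) (c : ℝ) : Set (SpaceTime d) :=
  {Y | parabolicDist X Y < c}

/-- The diameter of `D` with respect to the parabolic distance, as an extended real. -/
def parabolicDiam {d : ℕ} (D : Set (SpaceTime d)) : ℝ≥0∞ :=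
  ⨆ X ∈ D, ⨆ Y ∈ D, ENNReal.ofReal (parabolicDist X Y)

/-- The strip `𝒪_T = (0, T) × ℝ^d`, where `T = ∞` is allowed. -/
def timeStrip (d : ℕ) (T : EReal) : Set (SpaceTime d) :=
  {X | 0 < X.1 ∧ (X.1 : EReal) < T}

/-- `D` is of `A`-type with constant `A`:
`|D ∩ Q_ρ(X)| ≥ A |Q_ρ(X)|` for all `X ∈ D` and `0 < ρ ≤ diam D`. -/
def IsATypeWith {d : ℕ} (A : ℝ≥0) (D : Set (SpaceTime d)) : Prop :=
  ∀ X ∈ D, ∀ ρ : ℝ, 0 < ρ → ENNReal.ofReal ρ ≤ parabolicDiam D →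
    (A : ℝ≥0∞) * volume (parabolicBall X ρ) ≤ volume (D ∩ parabolicBall X ρ)

/-- The expected oscillation `𝔼 ∫_Q ∫_Q |h(Y) - h(Z)|^p dZ dY` of a random field `h` over `Q`. -/
def expectedOscillation {d : ℕ} {Ω : Type*} [MeasurableSpace Ω] (P : Measure Ω) (p : ℝ)
    (Q : Set (SpaceTime d)) (h : SpaceTime d → Ω → ℝ) : ℝ≥0∞ :=
  ∫⁻ ω, (∫⁻ Y in Q, (∫⁻ Z in Q, ‖h Y ω - h Z ω‖ₑ ^ p ∂volume) ∂volume) ∂P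

/-- The stochastic Campanato seminorm of a random field `h` on `D`: the `p`-th root of the supremum,
over the sets `Q = D ∩ Q_ρ(X)` with `X ∈ D` and `0 < ρ ≤ diam D`, of
`|Q|^{-(1+θ)} 𝔼 ∫_Q ∫_Q |h(Y) - h(Z)|^p dZ dY`. -/
def stochCampanatoSeminorm {d : ℕ} {Ω : Type*} [MeasurableSpace Ω] (P : Measure Ω) (p θ : ℝ)
    (D : Set (SpaceTime d)) (h : SpaceTime d → Ω → ℝ) : ℝ≥0∞ :=
  (⨆ X ∈ D, ⨆ ρ : ℝ, ⨆ _ : 0 < ρ ∧ ENNReal.ofReal ρ ≤ parabolicDiam D,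
    expectedOscillation P p (D ∩ parabolicBall X ρ) h /
      volume (D ∩ parabolicBall X ρ) ^ (1 + θ)) ^ (1 / p)

/-- A (deterministic) step function on `(0, t]`: a finite linear combination of indicators of
intervals `(a_i, b_i]` contained in `(0, t]`. -/
structure TimeStepFun (t : ℝ≥0) where
  n : ℕ
  coeff : Fin n → ℝ
  left : Fin n → ℝ≥0
  right : Fin n → ℝ≥0
  left_le_right : ∀ i, left i ≤ right i
  right_le : ∀ i, right i ≤ t

/-- The step function `∑ c_i 1_{(a_i, b_i]}`. -/
def TimeStepFun.eval {t : ℝ≥0} (φ : TimeStepFun t) (r : ℝ) : ℝ :=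
  ∑ i, φ.coeff i * (Ioc (φ.left i : ℝ) (φ.right i : ℝ)).indicator (fun _ => (1 : ℝ)) r

/-- The elementary stochastic integral `∑ c_i (W(b_i) - W(a_i))`. -/
def TimeStepFun.integral {t : ℝ≥0} (φ : TimeStepFun t) {Ω : Type*} (W : ℝ≥0 → Ω → ℝ) (ω : Ω) : ℝ :=
  ∑ i, φ.coeff i * (W (φ.right i) ω - W (φ.left i) ω)

/-- `J` is (a version of) the stochastic integral `∫_0^t f(r) dW(r)` of the deterministic function
`f ∈ L²(0, t)`: the limit in `L²(Ω)` of the elementary integrals of step functions that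
converge to `f` in `L²(0, t)`. -/
def IsWienerIntegral {Ω : Type*} [MeasurableSpace Ω] (P : Measure Ω) (W : ℝ≥0 → Ω → ℝ)
    (t : ℝ≥0) (f : ℝ → ℝ) (J : Ω → ℝ) : Prop :=
  MemLp f 2 (volume.restrict (Ioc 0 (t : ℝ))) ∧ MemLp J 2 P ∧
    ∃ φ : ℕ → TimeStepFun t,
      Tendsto (fun k => eLpNorm (fun r => (φ k).eval r - f r) 2 (volume.restrict (Ioc 0 (t : ℝ))))
        atTop (𝓝 0) ∧
      Tendsto (fun k => eLpNorm (fun ω => (φ k).integral W ω - J ω) 2 P) atTop (𝓝 0)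

/-- `u` is (a version of) the stochastic convolution
`𝒦g(t, x) = ∫_0^t ∫_{ℝ^d} K(t - r, y) g(x - y) dy dW(r)` at all points `(t, x)` of `S`. -/
def IsStochConvolutionOn {d : ℕ} {Ω : Type*} [MeasurableSpace Ω] (P : Measure Ω)
    (W : ℝ≥0 → Ω → ℝ) (K : ℝ → EuclideanSpace ℝ (Fin d) → ℝ) (g : EuclideanSpace ℝ (Fin d) → ℝ)
    (S : Set (SpaceTime d)) (u : SpaceTime d → Ω → ℝ) : Prop :=
  ∀ X ∈ S, IsWienerIntegral P W X.1.toNNReal (fun r => ∫ y, K (X.1 - r) y * g (X.2 - y)) (u X)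

/-- The integral conditions on the kernel `K`, for all times `0 ≤ s < t ≤ T`, `t < ∞`. -/
structure KernelConditions {d : ℕ} (K : ℝ → EuclideanSpace ℝ (Fin d) → ℝ) (T : EReal)
    (β : ℝ) (γ₁ γ₂ : ℝ) (N₀ N₁ : ℝ≥0) : Prop where
  measurable : Measurable (Function.uncurry K)
  time_increment : ∀ s t : ℝ, 0 ≤ s → s < t → (t : EReal) ≤ T →
    ∫⁻ r in Ioc 0 s, (∫⁻ z, ‖K (t - r) z - K (s - r) z‖ₑ * ENNReal.ofReal (1 + ‖z‖ ^ β)) ^ 2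
      ≤ N₁ * ENNReal.ofReal ((t - s) ^ γ₁)
  mass : ∀ s t : ℝ, 0 ≤ s → s < t → (t : EReal) ≤ T →
    ∫⁻ r in Ioc 0 s, (∫⁻ z, ‖K (s - r) z‖ₑ) ^ 2 ≤ N₀
  short_time : ∀ s t : ℝ, 0 ≤ s → s < t → (t : EReal) ≤ T →
    ∫⁻ r in Ioc s t, (∫⁻ z, ‖K (t - r) z‖ₑ * ENNReal.ofReal (1 + ‖z‖ ^ β)) ^ 2
      ≤ N₁ * ENNReal.ofReal ((t - s) ^ γ₂)

end

/-! At X = (t, x) the convolution is the Wiener integral of the deterministic function f_X(r) = ∫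
K(t - r, y) g(x - y) dy. Increments of such integrals are L² limits of centred Gaussians, so every
L^q(Ω) norm is controlled by the L² norm in time of the difference of integrands
(`IsWienerIntegral.eLpNorm_sub_le`).

For Y = (s, x') with s ≤ t, that difference splits into three pieces: on (0, s], the kernel
increment against g(x - y) and the kernel against g(x - y) - g(x' - y); on (s, t], the kernel
against g(x - y). Since g(0) = 0, Hölder continuity gives |g(x - y)| ≲ 1 + |y|^β for bounded x, so
the kernel conditions bound the pieces by multiples of |t - s|^(γ₁/2), |x - x'|^β and |t - s|^(γ₂/2)
(`KernelConditions.eLpNorm_convolution_sub_le`).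

For two points of a parabolic ball of radius ρ ≤ diam D, all three are at most a constant times ρ^γ.
Integrating p-th powers over Q × Q gives (Cρ^γ)^p |Q|², and the A-type condition, ρ^(d+2) ≲ |Q|,
converts ρ^(γp) into |Q|^(γp/(d+2)) (`div_volume_rpow_le`).

The same increment bound with q = 2 makes the convolution a continuous map into L²(Ω), hence it has
a jointly measurable version (`exists_measurable_version`). -/

/-! ### Elementary integrals of step functions and their isometry -/

theorem TimeStepFun.measurable_eval {t : ℝ≥0} (φ : TimeStepFun t) : Measurable φ.eval := by
  unfold TimeStepFun.eval
  exact Finset.measurable_fun_sum _ fun i _ =>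
    (measurable_const.indicator measurableSet_Ioc).const_mul _

/-- The elementary integral is a linear functional of the finitely many values of W at the
endpoints. -/
theorem TimeStepFun.hasGaussianLaw_integral {t : ℝ≥0} (φ : TimeStepFun t) {Ω : Type*}
    [MeasurableSpace Ω] {P : Measure Ω} {W : ℝ≥0 → Ω → ℝ} (hW : IsPreBrownianReal W P) :
    HasGaussianLaw (φ.integral W) P := by
  classical
  have key : IsGaussianProcess (fun _ : Unit => φ.integral W) P := by
    refine hW.isGaussianProcess.of_isGaussianProcess fun _ => ?_
    let I : Finset ℝ≥0 := Finset.univ.image φ.left ∪ Finset.univ.image φ.right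
    have hl (i) : φ.left i ∈ I := by simp [I]
    have hr (i) : φ.right i ∈ I := by simp [I]
    exact ⟨I, ∑ i, φ.coeff i • (ContinuousLinearMap.proj (R := ℝ) (φ := fun _ : I => ℝ)
      ⟨φ.right i, hr i⟩ - ContinuousLinearMap.proj ⟨φ.left i, hl i⟩), fun ω => by
        simp [TimeStepFun.integral]⟩
  exact key.hasGaussianLaw_eval ()

theorem TimeStepFun.integral_integral_eq_zero {t : ℝ≥0} (φ : TimeStepFun t) {Ω : Type*}
    [MeasurableSpace Ω] {P : Measure Ω} {W : ℝ≥0 → Ω → ℝ} (hW : IsPreBrownianReal W P) :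
    ∫ ω, φ.integral W ω ∂P = 0 := by
  have hint (i) : Integrable (fun ω => W (φ.right i) ω - W (φ.left i) ω) P :=
    (hW.integrable_eval _).sub (hW.integrable_eval _)
  unfold TimeStepFun.integral
  rw [integral_finsetSum _ fun i _ => (hint i).const_mul _]
  refine Finset.sum_eq_zero fun i _ => ?_
  rw [integral_const_mul, integral_sub (hW.integrable_eval _) (hW.integrable_eval _),
    hW.integral_eval, hW.integral_eval, sub_zero, mul_zero]

/-- Bilinearity reduces this to an identity between minima. The right side is the length of the
overlap of the two intervals, that is, the L² inner product of their indicators. -/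
theorem IsPreBrownianReal.covariance_increments {Ω : Type*} [MeasurableSpace Ω] {P : Measure Ω}
    {W : ℝ≥0 → Ω → ℝ} (hW : IsPreBrownianReal W P) {a b a' b' : ℝ≥0} (h : a ≤ b) (h' : a' ≤ b') :
    cov[fun ω => W b ω - W a ω, fun ω => W b' ω - W a' ω; P] =
      max 0 ((min b b' : ℝ≥0) - (max a a' : ℝ≥0) : ℝ) := by
  have := hW.isGaussianProcess.isProbabilityMeasure
  have hm (s) : MemLp (W s) 2 P := (hW.isGaussianProcess.hasGaussianLaw_eval _).memLp_two
  have hm' (s) : MemLp (fun ω => W s ω) 2 P := hm s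
  rw [covariance_fun_sub_fun_sub (hm' _) (hm' _) (hm' _) (hm' _)]
  simp_rw [hW.covariance_fun_eval]
  have h1 : (a : ℝ) ≤ b := by exact_mod_cast h
  have h2 : (a' : ℝ) ≤ b' := by exact_mod_cast h'
  push_cast
  grind

theorem integral_indicator_mul_indicator_Ioc {t a b a' b' : ℝ} (ha : 0 ≤ a) (hb : b ≤ t) :
    ∫ r in Ioc 0 t, (Ioc a b).indicator (fun _ => (1 : ℝ)) r *
      (Ioc a' b').indicator (fun _ => (1 : ℝ)) r = max 0 (min b b' - max a a') := by
  have h1 : (fun r => (Ioc a b).indicator (fun _ => (1 : ℝ)) r *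
      (Ioc a' b').indicator (fun _ => (1 : ℝ)) r) =
      (Ioc (max a a') (min b b')).indicator (fun _ => (1 : ℝ)) := by
    funext r
    by_cases h : r ∈ Ioc a b <;> by_cases h' : r ∈ Ioc a' b' <;>
      (simp_all [indicator, mem_Ioc]; try grind)
  rw [h1, setIntegral_indicator measurableSet_Ioc, inter_eq_right.2]
  · simp [Measure.real, ENNReal.toReal_ofReal', max_comm]
  · exact Ioc_subset_Ioc (ha.trans (le_max_left _ _)) ((min_le_left _ _).trans hb)

/-- Both sides expand into double sums over pairs of intervals, which agree term by term. -/
theorem TimeStepFun.variance_integral {t : ℝ≥0} (φ : TimeStepFun t) {Ω : Type*}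
    [MeasurableSpace Ω] {P : Measure Ω} {W : ℝ≥0 → Ω → ℝ} (hW : IsPreBrownianReal W P) :
    Var[φ.integral W; P] = ∫ r in Ioc 0 (t : ℝ), φ.eval r ^ 2 := by
  have := hW.isGaussianProcess.isProbabilityMeasure
  have hm (s) : MemLp (W s) 2 P := (hW.isGaussianProcess.hasGaussianLaw_eval _).memLp_two
  unfold TimeStepFun.integral TimeStepFun.eval
  have hm' (i) : MemLp (fun ω => φ.coeff i * (W (φ.right i) ω - W (φ.left i) ω)) 2 P :=
    ((hm _).sub (hm _)).const_mul _
  rw [variance_fun_sum hm']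
  have hsq (r : ℝ) : (∑ i, φ.coeff i *
      (Ioc (φ.left i : ℝ) (φ.right i : ℝ)).indicator (fun _ => (1 : ℝ)) r) ^ 2 =
      ∑ i, ∑ j, φ.coeff i * (φ.coeff j *
        ((Ioc (φ.left i : ℝ) (φ.right i : ℝ)).indicator (fun _ => (1 : ℝ)) r *
        (Ioc (φ.left j : ℝ) (φ.right j : ℝ)).indicator (fun _ => (1 : ℝ)) r)) := by
    rw [sq, Finset.sum_mul_sum]
    exact Finset.sum_congr rfl fun i _ => Finset.sum_congr rfl fun j _ => by ring
  have hint (i j) : Integrable (fun r => φ.coeff i * (φ.coeff j *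
        ((Ioc (φ.left i : ℝ) (φ.right i : ℝ)).indicator (fun _ => (1 : ℝ)) r *
        (Ioc (φ.left j : ℝ) (φ.right j : ℝ)).indicator (fun _ => (1 : ℝ)) r)))
        (volume.restrict (Ioc 0 (t : ℝ))) := by
    refine (Integrable.const_mul ?_ _).const_mul _
    refine Integrable.of_bound (C := 1) (((measurable_const.indicator measurableSet_Ioc).mul
      (measurable_const.indicator measurableSet_Ioc)).aestronglyMeasurable) (ae_of_all _ fun r => ?_)
    rw [norm_mul]
    exact mul_le_one₀ ((norm_indicator_le_norm_self _ _).trans (by simp)) (norm_nonneg _)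
      ((norm_indicator_le_norm_self _ _).trans (by simp))
  simp_rw [hsq]
  rw [integral_finsetSum _ fun i _ => integrable_finsetSum _ fun j _ => hint i j]
  refine Finset.sum_congr rfl fun i _ => ?_
  rw [integral_finsetSum _ fun j _ => hint i j]
  refine Finset.sum_congr rfl fun j _ => ?_
  rw [covariance_const_mul_left, covariance_const_mul_right, integral_const_mul,
    integral_const_mul, IsPreBrownianReal.covariance_increments hW (φ.left_le_right i)
      (φ.left_le_right j), integral_indicator_mul_indicator_Ioc (by simp)
      (by exact_mod_cast φ.right_le i)]
  push_cast
  rfl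

theorem eLpNorm_two_eq_ofReal_sqrt {α : Type*} [MeasurableSpace α] {μ : Measure α} {f : α → ℝ}
    (hf : MemLp f 2 μ) : eLpNorm f 2 μ = ENNReal.ofReal √(∫ x, f x ^ 2 ∂μ) := by
  rw [hf.eLpNorm_eq_integral_rpow_norm (by simp) (by simp)]
  simp [Real.sqrt_eq_rpow]

theorem TimeStepFun.memLp_eval {t : ℝ≥0} (φ : TimeStepFun t) (q : ℝ≥0∞) :
    MemLp φ.eval q (volume.restrict (Ioc 0 (t : ℝ))) := by
  refine MemLp.of_bound φ.measurable_eval.aestronglyMeasurable (∑ i, |φ.coeff i|)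
    (ae_of_all _ fun r => ?_)
  refine (norm_sum_le _ _).trans (Finset.sum_le_sum fun i _ => ?_)
  rw [norm_mul]
  exact mul_le_of_le_one_right (norm_nonneg _)
    ((norm_indicator_le_norm_self _ _).trans (by simp))

/-- A centred Gaussian of variance v is √v times a standard one; v = 0 is included. -/
theorem eLpNorm_id_gaussianReal (q : ℝ≥0∞) (v : ℝ≥0) :
    eLpNorm id q (gaussianReal 0 v) =
      ENNReal.ofReal √v * eLpNorm id q (gaussianReal 0 1) := by
  have h := gaussianReal_map_const_mul (μ := 0) (v := 1) √v
  have hv : NNReal.mk (√(v : ℝ) ^ 2) (sq_nonneg _) * 1 = v := by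
    ext; simp
  rw [mul_zero, hv] at h
  rw [← h, eLpNorm_map_measure aestronglyMeasurable_id (by fun_prop)]
  have : (id ∘ fun x => √(v : ℝ) * x) = √(v : ℝ) • (id : ℝ → ℝ) := by
    funext x; simp
  rw [this, eLpNorm_const_smul, Real.enorm_eq_ofReal (Real.sqrt_nonneg _)]

/-- The Wiener isometry for step functions, in every `L^q(Ω)`. -/
theorem TimeStepFun.eLpNorm_integral {t : ℝ≥0} (φ : TimeStepFun t) {Ω : Type*}
    [MeasurableSpace Ω] {P : Measure Ω} {W : ℝ≥0 → Ω → ℝ} (hW : IsPreBrownianReal W P)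
    (q : ℝ≥0∞) :
    eLpNorm (φ.integral W) q P =
      eLpNorm id q (gaussianReal 0 1) * eLpNorm φ.eval 2 (volume.restrict (Ioc 0 (t : ℝ))) := by
  have hg := φ.hasGaussianLaw_integral hW
  have hmap := hg.map_eq_gaussianReal
  rw [φ.integral_integral_eq_zero hW, φ.variance_integral hW] at hmap
  have h1 : eLpNorm id q (P.map (φ.integral W)) = eLpNorm (φ.integral W) q P :=
    eLpNorm_map_measure aestronglyMeasurable_id hg.aemeasurable
  rw [← h1, hmap, eLpNorm_id_gaussianReal, eLpNorm_two_eq_ofReal_sqrt (φ.memLp_eval 2),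
    Real.coe_toNNReal _ (integral_nonneg fun r => sq_nonneg _), mul_comm]

/-! ### Comparison of Wiener integrals -/

/-- The difference of two step functions on `(0, t]` and `(0, s]`, `s ≤ t`. -/
def TimeStepFun.sub {s t : ℝ≥0} (h : s ≤ t) (φ : TimeStepFun t) (ψ : TimeStepFun s) :
    TimeStepFun t where
  n := φ.n + ψ.n
  coeff := Fin.append φ.coeff fun i => -ψ.coeff i
  left := Fin.append φ.left ψ.left
  right := Fin.append φ.right ψ.right
  left_le_right i := by
    refine Fin.addCases (fun i => ?_) (fun i => ?_) i
    · simpa using φ.left_le_right i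
    · simpa using ψ.left_le_right i
  right_le i := by
    refine Fin.addCases (fun i => ?_) (fun i => ?_) i
    · simpa using φ.right_le i
    · simpa using (ψ.right_le i).trans h

theorem TimeStepFun.eval_sub {s t : ℝ≥0} (h : s ≤ t) (φ : TimeStepFun t) (ψ : TimeStepFun s)
    (r : ℝ) : (φ.sub h ψ).eval r = φ.eval r - ψ.eval r := by
  refine (Fin.sum_univ_add _).trans ?_
  simp [TimeStepFun.eval, TimeStepFun.sub, sub_eq_add_neg]

theorem TimeStepFun.integral_sub {s t : ℝ≥0} (h : s ≤ t) (φ : TimeStepFun t) (ψ : TimeStepFun s)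
    {Ω : Type*} (W : ℝ≥0 → Ω → ℝ) (ω : Ω) :
    (φ.sub h ψ).integral W ω = φ.integral W ω - ψ.integral W ω := by
  refine (Fin.sum_univ_add _).trans ?_
  simp [TimeStepFun.integral, TimeStepFun.sub, sub_eq_add_neg]

theorem TimeStepFun.eval_eq_zero {t : ℝ≥0} (φ : TimeStepFun t) {r : ℝ} (hr : r ∉ Ioc 0 (t : ℝ)) :
    φ.eval r = 0 := by
  refine Finset.sum_eq_zero fun i _ => ?_
  have h2 : (φ.right i : ℝ) ≤ t := by exact_mod_cast φ.right_le i
  rw [indicator_of_notMem, mul_zero]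
  exact fun h => hr ⟨(φ.left i).2.trans_lt h.1, h.2.trans h2⟩

theorem eLpNorm_id_gaussianReal_ne_top {q : ℝ≥0∞} (hq : q ≠ ∞) :
    eLpNorm id q (gaussianReal 0 1) ≠ ∞ :=
  (memLp_id_gaussianReal' q hq).eLpNorm_ne_top

theorem TimeStepFun.memLp_integral {t : ℝ≥0} (φ : TimeStepFun t) {Ω : Type*}
    [MeasurableSpace Ω] {P : Measure Ω} {W : ℝ≥0 → Ω → ℝ} (hW : IsPreBrownianReal W P) :
    MemLp (φ.integral W) 2 P :=
  (φ.hasGaussianLaw_integral hW).memLp_two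

theorem eLpNorm_indicator_Ioc {s t : ℝ≥0} (h : s ≤ t) (f : ℝ → ℝ) (q : ℝ≥0∞) :
    eLpNorm ((Ioc 0 (s : ℝ)).indicator f) q (volume.restrict (Ioc 0 (t : ℝ))) =
      eLpNorm f q (volume.restrict (Ioc 0 (s : ℝ))) := by
  rw [eLpNorm_indicator_eq_eLpNorm_restrict measurableSet_Ioc,
    Measure.restrict_restrict measurableSet_Ioc, inter_eq_left.2]
  exact Ioc_subset_Ioc le_rfl (by exact_mod_cast h)

/-- If `f k → F` and `g k → G` in `L²`, then `f k - g k → F - G` in `L²`. -/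
theorem tendsto_eLpNorm_sub_sub {α : Type*} [MeasurableSpace α] {μ : Measure α}
    {f g : ℕ → α → ℝ} {F G : α → ℝ} (hf : ∀ k, AEStronglyMeasurable (f k) μ)
    (hg : ∀ k, AEStronglyMeasurable (g k) μ) (hF : AEStronglyMeasurable F μ)
    (hG : AEStronglyMeasurable G μ)
    (h : Tendsto (fun k => eLpNorm (fun x => f k x - F x) 2 μ) atTop (𝓝 0))
    (h' : Tendsto (fun k => eLpNorm (fun x => g k x - G x) 2 μ) atTop (𝓝 0)) :
    Tendsto (fun k => eLpNorm (fun x => (f k x - g k x) - (F x - G x)) 2 μ) atTop (𝓝 0) := by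
  refine tendsto_of_tendsto_of_tendsto_of_le_of_le tendsto_const_nhds
    (by simpa using h.add h') (fun _ => zero_le) fun k => ?_
  have : (fun x => (f k x - g k x) - (F x - G x)) =
      (fun x => f k x - F x) - fun x => g k x - G x := by
    funext x; simp; ring
  simp only [this]
  exact eLpNorm_sub_le ((hf k).sub hF) ((hg k).sub hG) (by norm_num)

/-- Wiener isometry in `L^q(Ω)`: the `L^q(Ω)` distance of two Wiener integrals is controlled
by the `L²` distance of the integrands. -/
theorem IsWienerIntegral.eLpNorm_sub_le {Ω : Type*} [MeasurableSpace Ω] {P : Measure Ω}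
    {W : ℝ≥0 → Ω → ℝ} (hW : IsPreBrownianReal W P) {s t : ℝ≥0} (hst : s ≤ t) {f f' : ℝ → ℝ}
    {J J' : Ω → ℝ} (hJ : IsWienerIntegral P W t f J) (hJ' : IsWienerIntegral P W s f' J')
    {q : ℝ≥0∞} (hq : q ≠ ∞) :
    eLpNorm (fun ω => J ω - J' ω) q P ≤ eLpNorm id q (gaussianReal 0 1) *
      eLpNorm (fun r => f r - (Ioc 0 (s : ℝ)).indicator f' r) 2
        (volume.restrict (Ioc 0 (t : ℝ))) := by
  obtain ⟨hf, hJm, φ, hφ, hφJ⟩ := hJ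
  obtain ⟨hf', hJm', ψ, hψ, hψJ⟩ := hJ'
  have hind : AEStronglyMeasurable ((Ioc 0 (s : ℝ)).indicator f')
      (volume.restrict (Ioc 0 (t : ℝ))) := by
    rw [aestronglyMeasurable_indicator_iff measurableSet_Ioc,
      Measure.restrict_restrict measurableSet_Ioc, inter_eq_left.2
        (Ioc_subset_Ioc le_rfl (by exact_mod_cast hst))]
    exact hf'.1
  -- Step functions on (0, s] vanish beyond s, so the same sequence approximates the zero extension
  -- of `f'`.
  have hψ' : Tendsto (fun k => eLpNorm (fun r => (ψ k).eval r -
      (Ioc 0 (s : ℝ)).indicator f' r) 2 (volume.restrict (Ioc 0 (t : ℝ)))) atTop (𝓝 0) := by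
    refine hψ.congr fun k => ?_
    rw [← eLpNorm_indicator_Ioc hst]
    congr 1
    funext r
    by_cases hr : r ∈ Ioc 0 (s : ℝ)
    · simp [hr]
    · simp only [indicator_of_notMem hr, (ψ k).eval_eq_zero hr, sub_zero]
  have hA := tendsto_eLpNorm_sub_sub (fun k => ((φ k).memLp_integral hW).1)
    (fun k => ((ψ k).memLp_integral hW).1) hJm.1 hJm'.1 hφJ hψJ
  have hB := tendsto_eLpNorm_sub_sub (fun k => (φ k).measurable_eval.aestronglyMeasurable)
    (fun k => (ψ k).measurable_eval.aestronglyMeasurable) hf.1 hind hφ hψ'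
  simp_rw [← TimeStepFun.integral_sub hst] at hA
  simp_rw [← TimeStepFun.eval_sub hst] at hB
  set χ : ℕ → TimeStepFun t := fun k => (φ k).sub hst (ψ k) with hχ
  set G := fun r => f r - (Ioc 0 (s : ℝ)).indicator f' r with hG
  have hGm : AEStronglyMeasurable G (volume.restrict (Ioc 0 (t : ℝ))) := hf.1.sub hind
  -- Convergence is known only in L²(Ω). Almost sure convergence along a subsequence and Fatou carry
  -- the bound to every finite q.
  obtain ⟨ns, hns, hae⟩ := (tendstoInMeasure_of_tendsto_eLpNorm (p := 2) (by norm_num)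
    (fun k => ((χ k).memLp_integral hW).1) (hJm.1.sub hJm'.1) hA).exists_seq_tendsto_ae
  refine (Lp.eLpNorm_lim_le_liminf_eLpNorm (fun k => ((χ (ns k)).memLp_integral hW).1) _ hae).trans
    ?_
  have hC := eLpNorm_id_gaussianReal_ne_top hq
  have hlim : Tendsto (fun k => eLpNorm id q (gaussianReal 0 1) *
      (eLpNorm (fun r => (χ (ns k)).eval r - G r) 2 (volume.restrict (Ioc 0 (t : ℝ))) +
        eLpNorm G 2 (volume.restrict (Ioc 0 (t : ℝ))))) atTop
      (𝓝 (eLpNorm id q (gaussianReal 0 1) * (0 + eLpNorm G 2 (volume.restrict (Ioc 0 (t : ℝ)))))) :=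
    ENNReal.Tendsto.const_mul ((hB.comp hns.tendsto_atTop).add tendsto_const_nhds) (Or.inr hC)
  rw [zero_add] at hlim
  rw [← hlim.liminf_eq]
  refine liminf_le_liminf (Eventually.of_forall fun k => ?_)
  rw [(χ (ns k)).eLpNorm_integral hW]
  gcongr
  have : (χ (ns k)).eval = (fun r => (χ (ns k)).eval r - G r) + G := by
    funext r; simp
  calc eLpNorm (χ (ns k)).eval 2 (volume.restrict (Ioc 0 (t : ℝ)))
      = eLpNorm ((fun r => (χ (ns k)).eval r - G r) + G) 2 (volume.restrict (Ioc 0 (t : ℝ))) := by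
        rw [← this]
    _ ≤ _ := eLpNorm_add_le ((χ (ns k)).measurable_eval.aestronglyMeasurable.sub hGm) hGm
        (by norm_num)

/-! ### Existence of Wiener integrals -/

/-- The step function taking the value `g (t (i + 1) / n)` on `(t i / n, t (i + 1) / n]`. -/
noncomputable def TimeStepFun.sample (t : ℝ≥0) (n : ℕ) (g : ℝ → ℝ) : TimeStepFun t where
  n := n
  coeff i := g (t * (i + 1) / n)
  left i := t * i / n
  right i := t * (i + 1) / n
  left_le_right i := by gcongr; simp
  right_le i := by
    have : ((i : ℕ) : ℝ≥0) + 1 ≤ n := by exact_mod_cast i.2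
    have hn : (0 : ℝ≥0) < n := lt_of_lt_of_le (by positivity) this
    rw [div_le_iff₀ hn]
    exact mul_le_mul_right this _

theorem TimeStepFun.exists_sample_eval_eq (t : ℝ≥0) {n : ℕ} (hn : 0 < n) (g : ℝ → ℝ) {r : ℝ}
    (hr : r ∈ Ioc 0 (t : ℝ)) :
    ∃ b : ℝ, (TimeStepFun.sample t n g).eval r = g b ∧ |b - r| ≤ t / n := by
  have ht : (0 : ℝ) < t := hr.1.trans_le hr.2
  have hn' : (0 : ℝ) < n := by exact_mod_cast hn
  -- Cells are open on the left and closed on the right, so the ceiling counts them from 1 and the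
  -- index of the cell containing r is m - 1.
  set m := ⌈r * n / t⌉₊ with hm
  have hm0 : 0 < m := Nat.ceil_pos.2 (by have := hr.1; positivity)
  have hmn : m ≤ n := by
    rw [hm, Nat.ceil_le, div_le_iff₀ ht, mul_comm]
    exact mul_le_mul_of_nonneg_left hr.2 hn'.le
  have key (i : ℕ) : r ∈ Ioc ((t : ℝ) * i / n) ((t : ℝ) * (i + 1) / n) ↔ i + 1 = m := by
    rw [hm, eq_comm, Nat.ceil_eq_iff (by omega), mem_Ioc, div_lt_iff₀ hn', le_div_iff₀ hn',
      lt_div_iff₀ ht, div_le_iff₀ ht, mul_comm (t : ℝ), mul_comm (t : ℝ)]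
    push_cast
    rfl
  have hj : m - 1 < n := by omega
  have hmem := (key (m - 1)).2 (by omega)
  refine ⟨(t : ℝ) * ((m - 1 : ℕ) + 1) / n, ?_, ?_⟩
  · unfold TimeStepFun.eval
    have : ∀ i : Fin n, i ≠ ⟨m - 1, hj⟩ →
        r ∉ Ioc ((t : ℝ) * (i : ℕ) / n) ((t : ℝ) * ((i : ℕ) + 1) / n) := by
      intro i hi h
      exact hi (Fin.ext (by have := (key i).1 h; simp; omega))
    simp only [TimeStepFun.sample]
    push_cast
    rw [Finset.sum_eq_single (⟨m - 1, hj⟩ : Fin n)]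
    · rw [indicator_of_mem hmem, mul_one]
    · intro i _ hi
      rw [indicator_of_notMem (this i hi), mul_zero]
    · exact fun h => absurd (Finset.mem_univ _) h
  · have : (t : ℝ) * ((m - 1 : ℕ) + 1) / n = (t : ℝ) * (m - 1 : ℕ) / n + t / n := by ring
    rw [abs_of_nonneg (by linarith [hmem.2])]
    linarith [hmem.1]

/-- Continuous compactly supported functions are dense in L², and uniform continuity lets a fine
sampling of one approximate it uniformly. -/
theorem TimeStepFun.exists_eLpNorm_sub_le {t : ℝ≥0} {f : ℝ → ℝ}
    (hf : MemLp f 2 (volume.restrict (Ioc 0 (t : ℝ)))) {ε : ℝ≥0∞} (hε : ε ≠ 0) :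
    ∃ φ : TimeStepFun t,
      eLpNorm (fun r => φ.eval r - f r) 2 (volume.restrict (Ioc 0 (t : ℝ))) ≤ ε := by
  have hε2 : ε / 2 ≠ 0 := by simp [hε]
  obtain ⟨g, hgc, hg, hgcont, hgm⟩ := hf.exists_hasCompactSupport_eLpNorm_sub_le (by simp) hε2
  have huc := hgc.uniformContinuous_of_continuous hgcont
  obtain ⟨η, hη, hη'⟩ : ∃ η : ℝ, 0 < η ∧
      (volume.restrict (Ioc 0 (t : ℝ))) univ ^ (2 : ℝ≥0∞).toReal⁻¹ * ENNReal.ofReal η ≤ ε / 2 := by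
    have : Tendsto (fun η : ℝ => (volume.restrict (Ioc 0 (t : ℝ))) univ ^ (2 : ℝ≥0∞).toReal⁻¹ *
        ENNReal.ofReal η) (𝓝[>] 0) (𝓝 ((volume.restrict (Ioc 0 (t : ℝ))) univ ^
          (2 : ℝ≥0∞).toReal⁻¹ * ENNReal.ofReal 0)) := by
      refine ENNReal.Tendsto.const_mul ?_ (Or.inr (by simp))
      exact (ENNReal.continuous_ofReal.tendsto 0).mono_left nhdsWithin_le_nhds
    rw [ENNReal.ofReal_zero, mul_zero] at this
    obtain ⟨η, h1, h2⟩ := ((this.eventually (ge_mem_nhds (pos_iff_ne_zero.2 hε2))).and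
      self_mem_nhdsWithin).exists
    exact ⟨η, h2, h1⟩
  obtain ⟨δ, hδ, hδ'⟩ := Metric.uniformContinuous_iff.1 huc η hη
  obtain ⟨n, hn⟩ := exists_nat_gt (t / δ)
  have hn0 : (0 : ℝ) < n := lt_of_le_of_lt (by positivity) hn
  refine ⟨TimeStepFun.sample t n g, ?_⟩
  set φ := TimeStepFun.sample t n g
  have h1 : eLpNorm (fun r => φ.eval r - g r) 2 (volume.restrict (Ioc 0 (t : ℝ))) ≤ ε / 2 := by
    refine (eLpNorm_le_of_ae_bound (C := η) ?_).trans hη'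
    filter_upwards [ae_restrict_mem measurableSet_Ioc] with r hr
    obtain ⟨b, hb, hbr⟩ := TimeStepFun.exists_sample_eval_eq t (by exact_mod_cast hn0) g hr
    rw [hb, ← dist_eq_norm]
    refine (hδ' ?_).le
    rw [Real.dist_eq]
    refine hbr.trans_lt ?_
    rwa [div_lt_iff₀ hn0, mul_comm, ← div_lt_iff₀ hδ]
  have h2 : eLpNorm (g - f) 2 (volume.restrict (Ioc 0 (t : ℝ))) ≤ ε / 2 := by
    rwa [eLpNorm_sub_comm]
  have : (fun r => φ.eval r - f r) = (fun r => φ.eval r - g r) + (g - f) := by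
    funext r; simp
  rw [this]
  refine (eLpNorm_add_le (φ.measurable_eval.aestronglyMeasurable.sub hgm.1) (hgm.1.sub hf.1)
    (by norm_num)).trans ?_
  exact (add_le_add h1 h2).trans (ENNReal.add_halves ε).le

/-- Step functions within 2^(-k) of f have elementary integrals that are Cauchy by the isometry, and
L²(Ω) is complete. -/
theorem exists_isWienerIntegral {Ω : Type*} [MeasurableSpace Ω] {P : Measure Ω}
    {W : ℝ≥0 → Ω → ℝ} (hW : IsPreBrownianReal W P) {t : ℝ≥0} {f : ℝ → ℝ}
    (hf : MemLp f 2 (volume.restrict (Ioc 0 (t : ℝ)))) :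
    ∃ J : Lp ℝ 2 P, IsWienerIntegral P W t f J := by
  have hε (k : ℕ) : ((2⁻¹ : ℝ≥0∞) ^ k) ≠ 0 := pow_ne_zero _ (by simp)
  choose φ hφ using fun k => TimeStepFun.exists_eLpNorm_sub_le hf (hε k)
  have hm (k) := (φ k).memLp_integral hW
  have hC : eLpNorm id 2 (gaussianReal 0 1) ≠ ∞ := eLpNorm_id_gaussianReal_ne_top (by simp)
  have hcau : CauchySeq fun k => (hm k).toLp := by
    refine cauchySeq_of_edist_le_geometric 2⁻¹ (eLpNorm id 2 (gaussianReal 0 1) * 2)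
      (by simp [ENNReal.inv_lt_one]) (ENNReal.mul_ne_top hC (by simp)) fun k => ?_
    rw [Lp.edist_toLp_toLp]
    have h1 : (φ k).integral W - (φ (k + 1)).integral W =
        ((φ k).sub le_rfl (φ (k + 1))).integral W := by
      funext ω; rw [TimeStepFun.integral_sub]; rfl
    have h2 : ((φ k).sub le_rfl (φ (k + 1))).eval = (fun r => (φ k).eval r - f r) -
        fun r => (φ (k + 1)).eval r - f r := by
      funext r; rw [TimeStepFun.eval_sub]; simp
    rw [h1, TimeStepFun.eLpNorm_integral _ hW, h2, mul_assoc]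
    gcongr
    refine (eLpNorm_sub_le ((φ k).measurable_eval.aestronglyMeasurable.sub hf.1)
      ((φ (k + 1)).measurable_eval.aestronglyMeasurable.sub hf.1) (by norm_num)).trans ?_
    rw [two_mul]
    refine add_le_add (hφ k) ((hφ (k + 1)).trans ?_)
    rw [pow_succ]
    exact mul_le_of_le_one_right' (by simp)
  obtain ⟨J, hJ⟩ := cauchySeq_tendsto_of_complete hcau
  refine ⟨J, hf, Lp.memLp J, φ, ?_, ?_⟩
  · exact tendsto_of_tendsto_of_tendsto_of_le_of_le tendsto_const_nhds
      (ENNReal.tendsto_pow_atTop_nhds_zero_of_lt_one (by simp [ENNReal.inv_lt_one]))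
      (fun _ => zero_le) hφ
  · rw [tendsto_iff_edist_tendsto_0] at hJ
    refine hJ.congr fun k => ?_
    rw [Lp.edist_def]
    refine eLpNorm_congr_ae ?_
    filter_upwards [(hm k).coeFn_toLp] with ω hω
    simp [hω]

theorem IsWienerIntegral.congr_ae {Ω : Type*} [MeasurableSpace Ω] {P : Measure Ω}
    {W : ℝ≥0 → Ω → ℝ} {t : ℝ≥0} {f : ℝ → ℝ} {J J' : Ω → ℝ} (hJ : IsWienerIntegral P W t f J)
    (h : J =ᵐ[P] J') : IsWienerIntegral P W t f J' := by
  obtain ⟨hf, hJm, φ, hφ, hφJ⟩ := hJ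
  refine ⟨hf, (memLp_congr_ae h).1 hJm, φ, hφ, hφJ.congr fun k => eLpNorm_congr_ae ?_⟩
  filter_upwards [h] with ω hω
  rw [hω]

/-! ### Deterministic estimates for the convolution integrand -/

theorem ofReal_one_add_norm_rpow {E : Type*} [SeminormedAddCommGroup E] (z : E) (β : ℝ≥0) :
    ENNReal.ofReal (1 + ‖z‖ ^ (β : ℝ)) = 1 + ‖z‖ₑ ^ (β : ℝ) := by
  rw [ENNReal.ofReal_add zero_le_one (by positivity), ENNReal.ofReal_one,
    ← ENNReal.ofReal_rpow_of_nonneg (norm_nonneg _) β.coe_nonneg, ofReal_norm]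

/-- Comparison with g(0) = 0 gives |x - y|^β, and r ↦ r^β is subadditive for β ≤ 1. This produces
the weight of the kernel conditions. -/
theorem HolderWith.enorm_le_of_map_zero {E : Type*} [SeminormedAddCommGroup E] {g : E → ℝ}
    {C β R : ℝ≥0} (hg : HolderWith C β g) (g0 : g 0 = 0) (hβ1 : β ≤ 1) {x : E}
    (hx : ‖x‖ ≤ R) (y : E) :
    ‖g (x - y)‖ₑ ≤ (C * (1 + R ^ (β : ℝ)) : ℝ≥0) * ENNReal.ofReal (1 + ‖y‖ ^ (β : ℝ)) := by
  have hx' : ‖x‖ₑ ≤ R := by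
    rw [← ofReal_norm]
    exact ENNReal.ofReal_le_of_le_toReal (by simpa using hx)
  have h1 := hg (x - y) 0
  rw [g0, edist_zero_right, edist_zero_right] at h1
  rw [ofReal_one_add_norm_rpow]
  have h2 : ‖x - y‖ₑ ^ (β : ℝ) ≤ (R : ℝ≥0∞) ^ (β : ℝ) + ‖y‖ₑ ^ (β : ℝ) := by
    calc ‖x - y‖ₑ ^ (β : ℝ) ≤ (‖x‖ₑ + ‖y‖ₑ) ^ (β : ℝ) := by gcongr; exact enorm_sub_le
      _ ≤ ‖x‖ₑ ^ (β : ℝ) + ‖y‖ₑ ^ (β : ℝ) :=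
        ENNReal.rpow_add_le_add_rpow _ _ β.coe_nonneg (by exact_mod_cast hβ1)
      _ ≤ _ := by gcongr
  have h3 : (R : ℝ≥0∞) ^ (β : ℝ) = ((R ^ (β : ℝ) : ℝ≥0) : ℝ≥0∞) :=
    (ENNReal.coe_rpow_of_nonneg _ β.coe_nonneg).symm
  rw [h3] at h2
  calc ‖g (x - y)‖ₑ ≤ C * ‖x - y‖ₑ ^ (β : ℝ) := h1
    _ ≤ C * (((R ^ (β : ℝ) : ℝ≥0) : ℝ≥0∞) + ‖y‖ₑ ^ (β : ℝ)) := by gcongr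
    _ ≤ C * ((1 + (R ^ (β : ℝ) : ℝ≥0)) * (1 + ‖y‖ₑ ^ (β : ℝ))) := by
      gcongr
      rw [add_mul, one_mul, mul_add, mul_one]
      calc _ = 0 + ‖y‖ₑ ^ (β : ℝ) + (((R ^ (β : ℝ) : ℝ≥0) : ℝ≥0∞) + 0) := by
            rw [zero_add, add_zero, add_comm]
        _ ≤ _ := by gcongr <;> exact zero_le
    _ = _ := by push_cast; ring

section Kernel

variable {d : ℕ} {K : ℝ → EuclideanSpace ℝ (Fin d) → ℝ} {T : EReal} {β : ℝ≥0}
  {γ₁ γ₂ : ℝ} {N₀ N₁ : ℝ≥0} {g : EuclideanSpace ℝ (Fin d) → ℝ} {Cg R : ℝ≥0}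

theorem measurable_ofReal_one_add_norm_rpow (β : ℝ≥0) :
    Measurable fun z : EuclideanSpace ℝ (Fin d) => ENNReal.ofReal (1 + ‖z‖ ^ (β : ℝ)) :=
  ENNReal.measurable_ofReal.comp (measurable_const.add (measurable_norm.pow_const _))

theorem KernelConditions.measurable_shift (hK : KernelConditions K T β γ₁ γ₂ N₀ N₁) (t : ℝ) :
    Measurable fun q : ℝ × EuclideanSpace ℝ (Fin d) => K (t - q.1) q.2 :=
  hK.measurable.comp ((measurable_const.sub measurable_fst).prodMk measurable_snd)

theorem KernelConditions.measurable_mass (hK : KernelConditions K T β γ₁ γ₂ N₀ N₁) (s : ℝ) :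
    Measurable fun r => ∫⁻ z, ‖K (s - r) z‖ₑ :=
  Measurable.lintegral_prod_right' (hK.measurable_shift s).enorm

theorem KernelConditions.measurable_weighted (hK : KernelConditions K T β γ₁ γ₂ N₀ N₁) (t : ℝ) :
    Measurable fun r => ∫⁻ z, ‖K (t - r) z‖ₑ * ENNReal.ofReal (1 + ‖z‖ ^ (β : ℝ)) :=
  Measurable.lintegral_prod_right' ((hK.measurable_shift t).enorm.mul
    ((measurable_ofReal_one_add_norm_rpow β).comp measurable_snd))

theorem KernelConditions.measurable_increment (hK : KernelConditions K T β γ₁ γ₂ N₀ N₁)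
    (s t : ℝ) :
    Measurable fun r => ∫⁻ z, ‖K (t - r) z - K (s - r) z‖ₑ *
      ENNReal.ofReal (1 + ‖z‖ ^ (β : ℝ)) :=
  Measurable.lintegral_prod_right' (((hK.measurable_shift t).sub (hK.measurable_shift s)).enorm.mul
    ((measurable_ofReal_one_add_norm_rpow β).comp measurable_snd))

theorem KernelConditions.ae_weighted_lt_top (hK : KernelConditions K T β γ₁ γ₂ N₀ N₁) {t : ℝ}
    (ht : 0 < t) (htT : (t : EReal) ≤ T) : ∀ᵐ r ∂volume.restrict (Ioc 0 t),
      ∫⁻ z, ‖K (t - r) z‖ₑ * ENNReal.ofReal (1 + ‖z‖ ^ (β : ℝ)) < ∞ := by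
  have h := hK.short_time 0 t le_rfl ht htT
  filter_upwards [ae_lt_top ((hK.measurable_weighted t).pow_const 2)
    (ne_top_of_le_ne_top (by finiteness) h)] with r hr
  simpa using hr

theorem lintegral_enorm_mul_le (hg : HolderWith Cg β g) (g0 : g 0 = 0) (hβ1 : β ≤ 1)
    {x : EuclideanSpace ℝ (Fin d)} (hx : ‖x‖ ≤ R) (k : EuclideanSpace ℝ (Fin d) → ℝ) :
    ∫⁻ y, ‖k y * g (x - y)‖ₑ ≤ (Cg * (1 + R ^ (β : ℝ)) : ℝ≥0) *
      ∫⁻ y, ‖k y‖ₑ * ENNReal.ofReal (1 + ‖y‖ ^ (β : ℝ)) := by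
  rw [← lintegral_const_mul' _ _ ENNReal.coe_ne_top]
  refine lintegral_mono fun y => ?_
  rw [enorm_mul, mul_left_comm]
  gcongr
  exact hg.enorm_le_of_map_zero g0 hβ1 hx y

theorem KernelConditions.ae_integrable (hK : KernelConditions K T β γ₁ γ₂ N₀ N₁)
    (hg : HolderWith Cg β g) (g0 : g 0 = 0) (hβ : 0 < β) (hβ1 : β ≤ 1) {t : ℝ}
    (ht : 0 < t) (htT : (t : EReal) ≤ T) (x : EuclideanSpace ℝ (Fin d)) :
    ∀ᵐ r ∂volume.restrict (Ioc 0 t), Integrable fun y => K (t - r) y * g (x - y) := by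
  filter_upwards [hK.ae_weighted_lt_top ht htT] with r hr
  refine ⟨?_, lt_of_le_of_lt (lintegral_enorm_mul_le hg g0 hβ1 (R := ‖x‖₊) (by simp) _)
    (ENNReal.mul_lt_top ENNReal.coe_lt_top hr)⟩
  exact ((hK.measurable.comp measurable_prodMk_left).mul ((hg.continuous hβ).comp
    (continuous_const.sub continuous_id)).measurable).aestronglyMeasurable

theorem KernelConditions.measurable_convolution (hK : KernelConditions K T β γ₁ γ₂ N₀ N₁)
    (hg : HolderWith Cg β g) (hβ : 0 < β) (t : ℝ) (x : EuclideanSpace ℝ (Fin d)) :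
    StronglyMeasurable fun r => ∫ y, K (t - r) y * g (x - y) := by
  refine StronglyMeasurable.integral_prod_right (f := fun r y => K (t - r) y * g (x - y)) ?_
  exact ((hK.measurable_shift t).mul ((hg.continuous hβ).comp
    (continuous_const.sub continuous_snd)).measurable).stronglyMeasurable

/-- Puts the kernel conditions, which live on different time intervals, into L² norms over one
common interval. -/
theorem eLpNorm_two_indicator_const_mul_le {α : Type*} [MeasurableSpace α] {μ : Measure α}
    {S U : Set α} (hS : MeasurableSet S) (hSU : S ⊆ U) {h : α → ℝ≥0∞}
    (C : ℝ≥0) {B : ℝ≥0∞} (hB : ∫⁻ r in S, h r ^ 2 ∂μ ≤ B) :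
    eLpNorm (S.indicator fun r => C * h r) 2 (μ.restrict U) ≤ C * B ^ (1 / 2 : ℝ) := by
  rw [eLpNorm_indicator_eq_eLpNorm_restrict hS, Measure.restrict_restrict hS,
    inter_eq_left.2 hSU, eLpNorm_eq_lintegral_rpow_enorm_toReal (by simp) (by simp)]
  simp only [enorm_eq_self, ENNReal.toReal_ofNat, ENNReal.rpow_ofNat, mul_pow]
  rw [lintegral_const_mul' _ _ (by finiteness), ENNReal.mul_rpow_of_nonneg _ _ (by norm_num)]
  have : ((C : ℝ≥0∞) ^ 2) ^ (1 / 2 : ℝ) = C := by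
    rw [← ENNReal.rpow_natCast, ← ENNReal.rpow_mul]; norm_num
  rw [this]
  gcongr

theorem KernelConditions.memLp_convolution (hK : KernelConditions K T β γ₁ γ₂ N₀ N₁)
    (hg : HolderWith Cg β g) (g0 : g 0 = 0) (hβ : 0 < β) (hβ1 : β ≤ 1) {t : ℝ}
    (ht : 0 < t) (htT : (t : EReal) ≤ T) (x : EuclideanSpace ℝ (Fin d)) :
    MemLp (fun r => ∫ y, K (t - r) y * g (x - y)) 2 (volume.restrict (Ioc 0 t)) := by
  refine ⟨(hK.measurable_convolution hg hβ t x).aestronglyMeasurable, ?_⟩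
  have h := eLpNorm_two_indicator_const_mul_le measurableSet_Ioc (Subset.refl (Ioc 0 t))
    (Cg * (1 + ‖x‖₊ ^ (β : ℝ))) (hK.short_time 0 t le_rfl ht htT)
  refine lt_of_le_of_lt (le_trans (eLpNorm_mono_enorm_ae ?_) h) (by finiteness)
  filter_upwards [ae_restrict_mem measurableSet_Ioc] with r hr
  rw [indicator_of_mem hr, enorm_eq_self]
  exact (enorm_integral_le_lintegral_enorm _).trans
    (lintegral_enorm_mul_le hg g0 hβ1 (by simp) _)

/-- The mass condition at s needs an admissible later time; s < T supplies one. -/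
theorem KernelConditions.mass_le (hK : KernelConditions K T β γ₁ γ₂ N₀ N₁) {s : ℝ} (hs : 0 ≤ s)
    (hsT : (s : EReal) < T) : ∫⁻ r in Ioc 0 s, (∫⁻ z, ‖K (s - r) z‖ₑ) ^ 2 ≤ N₀ := by
  obtain ⟨t, ht, htT⟩ := EReal.lt_iff_exists_real_btwn.1 hsT
  exact hK.mass s t hs (by exact_mod_cast ht) htT.le

/-- Adding and subtracting k'(y) g(x - y) pairs the growth of g with the kernel increment and its
Hölder increment with k'. The latter is uniform in y, so k' needs no weight. -/
theorem enorm_integral_sub_integral_le (hg : HolderWith Cg β g) (g0 : g 0 = 0) (hβ1 : β ≤ 1)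
    {x x' : EuclideanSpace ℝ (Fin d)} (hx : ‖x‖ ≤ R) {k k' : EuclideanSpace ℝ (Fin d) → ℝ}
    (hkm : Measurable k) (hkm' : Measurable k') (hgm : Measurable g)
    (hk : Integrable fun y => k y * g (x - y)) (hk' : Integrable fun y => k' y * g (x' - y)) :
    ‖(∫ y, k y * g (x - y)) - ∫ y, k' y * g (x' - y)‖ₑ ≤
      (Cg * (1 + R ^ (β : ℝ)) : ℝ≥0) *
        (∫⁻ y, ‖k y - k' y‖ₑ * ENNReal.ofReal (1 + ‖y‖ ^ (β : ℝ))) +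
      (Cg * ‖x - x'‖₊ ^ (β : ℝ) : ℝ≥0) * ∫⁻ y, ‖k' y‖ₑ := by
  rw [← integral_sub hk hk']
  have hsplit (y) : k y * g (x - y) - k' y * g (x' - y) =
      (k y - k' y) * g (x - y) + k' y * (g (x - y) - g (x' - y)) := by ring
  have hm : Measurable fun y => ‖(k y - k' y) * g (x - y)‖ₑ :=
    ((hkm.sub hkm').mul (hgm.comp (measurable_const.sub measurable_id))).enorm
  calc _ ≤ ∫⁻ y, ‖k y * g (x - y) - k' y * g (x' - y)‖ₑ := enorm_integral_le_lintegral_enorm _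
    _ ≤ ∫⁻ y, (‖(k y - k' y) * g (x - y)‖ₑ +
          (Cg * ‖x - x'‖₊ ^ (β : ℝ) : ℝ≥0) * ‖k' y‖ₑ) := by
      refine lintegral_mono fun y => ?_
      simp only [hsplit]
      refine (enorm_add_le _ _).trans ?_
      gcongr
      rw [enorm_mul, mul_comm]
      gcongr
      have := hg (x - y) (x' - y)
      rw [edist_sub_right, edist_eq_enorm_sub, edist_eq_enorm_sub] at this
      refine this.trans (le_of_eq ?_)
      rw [ENNReal.coe_mul, ENNReal.coe_rpow_of_nonneg _ β.coe_nonneg]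
      rfl
    _ = (∫⁻ y, ‖(k y - k' y) * g (x - y)‖ₑ) +
        (Cg * ‖x - x'‖₊ ^ (β : ℝ) : ℝ≥0) * ∫⁻ y, ‖k' y‖ₑ := by
      rw [lintegral_add_left hm, lintegral_const_mul' _ _ ENNReal.coe_ne_top]
    _ ≤ _ := by
      gcongr
      exact lintegral_enorm_mul_le hg g0 hβ1 hx _

/-- The `L²`-in-time modulus of continuity of the deterministic convolution. -/
theorem KernelConditions.eLpNorm_convolution_sub_le (hK : KernelConditions K T β γ₁ γ₂ N₀ N₁)
    (hg : HolderWith Cg β g) (g0 : g 0 = 0) (hβ : 0 < β) (hβ1 : β ≤ 1) {s t : ℝ} (hs : 0 < s)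
    (hst : s ≤ t) (htT : (t : EReal) < T) {x x' : EuclideanSpace ℝ (Fin d)} (hx : ‖x‖ ≤ R) :
    eLpNorm (fun r => (∫ y, K (t - r) y * g (x - y)) -
        (Ioc 0 s).indicator (fun r => ∫ y, K (s - r) y * g (x' - y)) r) 2
        (volume.restrict (Ioc 0 t)) ≤
      (Cg * (1 + R ^ (β : ℝ)) : ℝ≥0) * (N₁ * ENNReal.ofReal ((t - s) ^ γ₁)) ^ (1 / 2 : ℝ) +
      (Cg * ‖x - x'‖₊ ^ (β : ℝ) : ℝ≥0) * (N₀ : ℝ≥0∞) ^ (1 / 2 : ℝ) +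
      (Cg * (1 + R ^ (β : ℝ)) : ℝ≥0) * (N₁ * ENNReal.ofReal ((t - s) ^ γ₂)) ^ (1 / 2 : ℝ) := by
  have hsT : (s : EReal) < T := lt_of_le_of_lt (by exact_mod_cast hst) htT
  have ht := hs.trans_le hst
  have hgm := (hg.continuous hβ).measurable
  have hinc : ∫⁻ r in Ioc 0 s, (∫⁻ z, ‖K (t - r) z - K (s - r) z‖ₑ *
      ENNReal.ofReal (1 + ‖z‖ ^ (β : ℝ))) ^ 2 ≤ N₁ * ENNReal.ofReal ((t - s) ^ γ₁) := by
    rcases hst.eq_or_lt with rfl | h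
    · simp
    · exact hK.time_increment s t hs.le h htT.le
  have hshort : ∫⁻ r in Ioc s t, (∫⁻ z, ‖K (t - r) z‖ₑ *
      ENNReal.ofReal (1 + ‖z‖ ^ (β : ℝ))) ^ 2 ≤ N₁ * ENNReal.ofReal ((t - s) ^ γ₂) := by
    rcases hst.eq_or_lt with rfl | h
    · simp
    · exact hK.short_time s t hs.le h htT.le
  have hsub : Ioc 0 s ⊆ Ioc 0 t := Ioc_subset_Ioc le_rfl hst
  set a := fun r => ∫⁻ z, ‖K (t - r) z - K (s - r) z‖ₑ * ENNReal.ofReal (1 + ‖z‖ ^ (β : ℝ)) with ha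
  set b := fun r => ∫⁻ z, ‖K (s - r) z‖ₑ with hb
  set c := fun r => ∫⁻ z, ‖K (t - r) z‖ₑ * ENNReal.ofReal (1 + ‖z‖ ^ (β : ℝ)) with hc
  have hA := eLpNorm_two_indicator_const_mul_le measurableSet_Ioc hsub
    (Cg * (1 + R ^ (β : ℝ))) hinc
  have hB := eLpNorm_two_indicator_const_mul_le measurableSet_Ioc hsub
    (Cg * ‖x - x'‖₊ ^ (β : ℝ)) (hK.mass_le hs.le hsT)
  have hC := eLpNorm_two_indicator_const_mul_le measurableSet_Ioc
    (Ioc_subset_Ioc hs.le le_rfl) (Cg * (1 + R ^ (β : ℝ))) hshort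
  refine le_trans ?_ (add_le_add (add_le_add hA hB) hC)
  have hAm : AEStronglyMeasurable ((Ioc 0 s).indicator fun r =>
      ((Cg * (1 + R ^ (β : ℝ)) : ℝ≥0) : ℝ≥0∞) * a r) (volume.restrict (Ioc 0 t)) :=
    (((hK.measurable_increment s t).const_mul _).indicator
      measurableSet_Ioc).aestronglyMeasurable
  have hBm : AEStronglyMeasurable ((Ioc 0 s).indicator fun r =>
      ((Cg * ‖x - x'‖₊ ^ (β : ℝ) : ℝ≥0) : ℝ≥0∞) * b r) (volume.restrict (Ioc 0 t)) :=
    (((hK.measurable_mass s).const_mul _).indicator measurableSet_Ioc).aestronglyMeasurable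
  have hCm : AEStronglyMeasurable ((Ioc s t).indicator fun r =>
      ((Cg * (1 + R ^ (β : ℝ)) : ℝ≥0) : ℝ≥0∞) * c r) (volume.restrict (Ioc 0 t)) :=
    (((hK.measurable_weighted t).const_mul _).indicator
      measurableSet_Ioc).aestronglyMeasurable
  refine le_trans (eLpNorm_mono_enorm_ae ?_)
    ((eLpNorm_add_le (hAm.add hBm) hCm (by norm_num)).trans
      (add_le_add (eLpNorm_add_le hAm hBm (by norm_num)) le_rfl))
  have hi' := (ae_restrict_iff' measurableSet_Ioc).1
    (hK.ae_integrable hg g0 hβ hβ1 hs hsT.le x')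
  filter_upwards [ae_restrict_mem measurableSet_Ioc, hK.ae_integrable hg g0 hβ hβ1 ht htT.le x,
    ae_restrict_of_ae hi'] with r hr h1 h2
  simp only [Pi.add_apply, enorm_eq_self]
  -- Up to time s only the majorants `a` and `b` are active; after s the second integrand is zero
  -- and only `c` remains.
  by_cases hrs : r ∈ Ioc 0 s
  · have hrn : r ∉ Ioc s t := fun h => absurd h.1 (not_lt.2 hrs.2)
    simp only [indicator_of_mem hrs, indicator_of_notMem hrn, add_zero]
    exact enorm_integral_sub_integral_le hg g0 hβ1 hx
      (hK.measurable.comp measurable_prodMk_left) (hK.measurable.comp measurable_prodMk_left)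
      hgm h1 (h2 hrs)
  · have hrn : r ∈ Ioc s t := ⟨not_le.1 fun h => hrs ⟨hr.1, h⟩, hr.2⟩
    simp only [indicator_of_notMem hrs, indicator_of_mem hrn, add_zero, sub_zero, zero_add]
    exact (enorm_integral_le_lintegral_enorm _).trans
      (lintegral_enorm_mul_le hg g0 hβ1 hx _)

end Kernel

/-! ### Increments of the stochastic convolution -/

theorem ENNReal.coe_mul_ofReal_rpow_sqrt (N : ℝ≥0) {x : ℝ} (hx : 0 ≤ x) (γ : ℝ) :
    ((N : ℝ≥0∞) * ENNReal.ofReal (x ^ γ)) ^ (1 / 2 : ℝ) =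
      (N ^ (1 / 2 : ℝ) : ℝ≥0) * ENNReal.ofReal (x ^ (γ / 2)) := by
  rw [ENNReal.mul_rpow_of_nonneg _ _ (by norm_num), ENNReal.coe_rpow_of_nonneg _ (by norm_num),
    ENNReal.ofReal_rpow_of_nonneg (by positivity) (by norm_num), ← Real.rpow_mul hx]
  ring_nf

/-- The modulus of continuity of the stochastic convolution, up to constants. -/
noncomputable def convolutionModulus {d : ℕ} (γ₁ γ₂ β : ℝ) (X Y : SpaceTime d) : ℝ :=
  |X.1 - Y.1| ^ (γ₁ / 2) + |X.1 - Y.1| ^ (γ₂ / 2) + ‖X.2 - Y.2‖ ^ β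

theorem convolutionModulus_comm {d : ℕ} (γ₁ γ₂ β : ℝ) (X Y : SpaceTime d) :
    convolutionModulus γ₁ γ₂ β X Y = convolutionModulus γ₁ γ₂ β Y X := by
  unfold convolutionModulus
  rw [abs_sub_comm, norm_sub_rev]

/-- The constant in the `L²` estimate for increments of the stochastic convolution. -/
noncomputable def convolutionConst (N₀ N₁ Cg R β : ℝ≥0) : ℝ≥0 :=
  Cg * (1 + R ^ (β : ℝ)) * N₁ ^ (1 / 2 : ℝ) + Cg * N₀ ^ (1 / 2 : ℝ)

section

variable {d : ℕ} {K : ℝ → EuclideanSpace ℝ (Fin d) → ℝ} {T : EReal} {β : ℝ≥0}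
  {γ₁ γ₂ : ℝ} {N₀ N₁ : ℝ≥0} {g : EuclideanSpace ℝ (Fin d) → ℝ} {Cg R : ℝ≥0}
  {Ω : Type*} [MeasurableSpace Ω] {P : Measure Ω} {W : ℝ≥0 → Ω → ℝ}

theorem IsStochConvolutionOn.eLpNorm_sub_le (hK : KernelConditions K T β γ₁ γ₂ N₀ N₁)
    (hg : HolderWith Cg β g) (g0 : g 0 = 0) (hβ : 0 < β) (hβ1 : β ≤ 1)
    (hW : IsPreBrownianReal W P) {S : Set (SpaceTime d)} (hS : S ⊆ timeStrip d T)
    {u : SpaceTime d → Ω → ℝ} (hu : IsStochConvolutionOn P W K g S u) {X Y : SpaceTime d}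
    (hX : X ∈ S) (hY : Y ∈ S) (hXR : ‖X.2‖ ≤ R) (hYR : ‖Y.2‖ ≤ R) {q : ℝ≥0∞} (hq : q ≠ ∞) :
    eLpNorm (fun ω => u X ω - u Y ω) q P ≤ eLpNorm id q (gaussianReal 0 1) *
      (convolutionConst N₀ N₁ Cg R β * ENNReal.ofReal (convolutionModulus γ₁ γ₂ β X Y)) := by
  -- The comparison of Wiener integrals extends the integrand with the shorter time interval by
  -- zero, so times must be ordered.
  wlog hle : Y.1 ≤ X.1 generalizing X Y
  · rw [convolutionModulus_comm]
    refine le_trans (le_of_eq ?_) (this hY hX hYR hXR (le_of_not_ge hle))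
    exact eLpNorm_sub_comm (u X) (u Y) q P
  have hYpos := (hS hY).1
  have hXpos := (hS hX).1
  refine (IsWienerIntegral.eLpNorm_sub_le hW (Real.toNNReal_le_toNNReal hle) (hu X hX) (hu Y hY)
    hq).trans ?_
  gcongr
  rw [Real.coe_toNNReal _ hYpos.le, Real.coe_toNNReal _ hXpos.le]
  refine (hK.eLpNorm_convolution_sub_le hg g0 hβ hβ1 hYpos hle (hS hX).2 hXR).trans ?_
  have hd : 0 ≤ X.1 - Y.1 := sub_nonneg.2 hle
  rw [ENNReal.coe_mul_ofReal_rpow_sqrt _ hd, ENNReal.coe_mul_ofReal_rpow_sqrt _ hd]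
  have hx : ((Cg * ‖X.2 - Y.2‖₊ ^ (β : ℝ) : ℝ≥0) : ℝ≥0∞) * (N₀ : ℝ≥0∞) ^ (1 / 2 : ℝ) =
      (Cg * N₀ ^ (1 / 2 : ℝ) : ℝ≥0) * ENNReal.ofReal (‖X.2 - Y.2‖ ^ (β : ℝ)) := by
    rw [← ENNReal.ofReal_rpow_of_nonneg (norm_nonneg _) β.coe_nonneg, ofReal_norm,
      ENNReal.coe_mul, ENNReal.coe_rpow_of_nonneg _ β.coe_nonneg, ENNReal.coe_mul,
      ENNReal.coe_rpow_of_nonneg _ (by norm_num)]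
    change (Cg : ℝ≥0∞) * ‖X.2 - Y.2‖ₑ ^ (β : ℝ) * _ = _
    ring
  unfold convolutionConst convolutionModulus
  rw [hx, abs_of_nonneg hd, ENNReal.ofReal_add (by positivity) (by positivity),
    ENNReal.ofReal_add (by positivity) (by positivity), mul_add (_ : ℝ≥0∞),
    mul_add (_ : ℝ≥0∞), ← mul_assoc,
    ← mul_assoc, ← ENNReal.coe_mul, add_right_comm]
  refine add_le_add (add_le_add ?_ ?_) ?_ <;> refine mul_le_mul_left (ENNReal.coe_le_coe.2 ?_) _
  · exact le_self_add
  · exact le_self_add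
  · exact le_add_self

end

/-! ### Jointly measurable versions -/

/-- An `L²(Ω)`-valued map, continuous on a measurable set, has a jointly measurable version. -/
theorem exists_measurable_version {α Ω : Type*} [TopologicalSpace α] [SecondCountableTopology α]
    [MeasurableSpace α] [OpensMeasurableSpace α] [MeasurableSpace Ω] {P : Measure Ω}
    [IsProbabilityMeasure P] {S : Set α} (hS : MeasurableSet S) {F : α → Lp ℝ 2 P}
    (hF : ContinuousOn F S) :
    ∃ u : α → Ω → ℝ, Measurable (Function.uncurry u) ∧ ∀ X ∈ S, u X =ᵐ[P] F X := by
  classical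
  rcases S.eq_empty_or_nonempty with rfl | hne
  · exact ⟨0, measurable_zero, by simp⟩
  have : Nonempty S := hne.to_subtype
  let x : ℕ → S := TopologicalSpace.denseSeq S
  have hFc : Continuous (S.domRestrict F) := continuousOn_iff_continuous_domRestrict.1 hF
  -- The k-th approximation at X uses the first point of a dense sequence whose value is
  -- 2^(-k)-close. Off S the condition is vacuous, so the index is defined everywhere.
  let p : ℕ → α → ℕ → Prop := fun k X n => X ∉ S ∨ edist (F X) (F (x n)) < (2⁻¹ : ℝ≥0∞) ^ k
  have hp (k) (X) : ∃ n, p k X n := by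
    by_cases hX : X ∈ S
    · have hopen : IsOpen {Z : S | edist (F X) (F Z) < (2⁻¹ : ℝ≥0∞) ^ k} :=
        isOpen_lt (continuous_const.edist hFc) continuous_const
      obtain ⟨n, hn⟩ := (TopologicalSpace.denseRange_denseSeq S).exists_mem_open hopen
        ⟨⟨X, hX⟩, by simpa using ENNReal.pow_pos (by simp) k⟩
      exact ⟨n, Or.inr hn⟩
    · exact ⟨0, Or.inl hX⟩
  have hpm (k n) : MeasurableSet {X | p k X n} := by
    have hopen : IsOpen {Z : S | edist (F Z) (F (x n)) < (2⁻¹ : ℝ≥0∞) ^ k} :=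
      isOpen_lt (hFc.edist continuous_const) continuous_const
    have : {X | p k X n} =
        Sᶜ ∪ Subtype.val '' {Z : S | edist (F Z) (F (x n)) < (2⁻¹ : ℝ≥0∞) ^ k} := by
      ext X
      by_cases hX : X ∈ S <;> simp [p, hX]
    rw [this]
    exact hS.compl.union (hS.subtype_image hopen.measurableSet)
  let N : ℕ → α → ℕ := fun k X => Nat.find (hp k X)
  have hN (k) : Measurable (N k) := measurable_find (hp k) (hpm k)
  let V : ℕ → α × Ω → ℝ := fun k y => F (x (N k y.1)) y.2
  have hV (k) : Measurable (V k) := by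
    have h : Measurable fun y : ℕ × Ω => (F (x y.1) : Ω → ℝ) y.2 :=
      measurable_from_prod_countable_right fun n => (Lp.stronglyMeasurable (F (x n))).measurable
    exact h.comp (((hN k).comp measurable_fst).prodMk measurable_snd)
  -- An extended-real limsup is measurable without any convergence, and equals the limit wherever a
  -- finite one exists.
  refine ⟨fun X ω => (limsup (fun k => (V k (X, ω) : EReal)) atTop).toReal, ?_, fun X hX => ?_⟩
  · exact (Measurable.limsup fun k => (hV k).coe_real_ereal).ereal_toReal
  have hVX (k) : Measurable fun ω => V k (X, ω) - F X ω :=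
    ((hV k).comp measurable_prodMk_left).sub (Lp.stronglyMeasurable (F X)).measurable
  have hclose (k) : eLpNorm (fun ω => V k (X, ω) - F X ω) 1 P ≤ (2⁻¹ : ℝ≥0∞) ^ k := by
    have h : edist (F X) (F (x (N k X))) < (2⁻¹ : ℝ≥0∞) ^ k :=
      (Nat.find_spec (hp k X)).resolve_left (not_not.2 hX)
    rw [edist_comm, Lp.edist_def] at h
    refine le_trans ?_ h.le
    exact eLpNorm_le_eLpNorm_of_exponent_le (by norm_num) (hVX k).aestronglyMeasurable
  -- Summable L¹ errors force almost sure convergence of the full sequence at each fixed X in S.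
  have hsum : ∫⁻ ω, ∑' k, ‖V k (X, ω) - F X ω‖ₑ ∂P ≠ ∞ := by
    rw [lintegral_tsum fun k => (hVX k).enorm.aemeasurable]
    refine ne_top_of_le_ne_top ?_ (ENNReal.tsum_le_tsum fun k =>
      (eLpNorm_one_eq_lintegral_enorm (μ := P)).symm.le.trans (hclose k))
    rw [ENNReal.tsum_geometric]
    simp
  have hmeas : Measurable fun ω => ∑' k, ‖V k (X, ω) - F X ω‖ₑ :=
    Measurable.tsum fun k => (hVX k).enorm
  filter_upwards [ae_lt_top hmeas hsum] with ω hω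
  have h0 := ENNReal.tendsto_atTop_zero_of_tsum_ne_top hω.ne
  have h1 : Tendsto (fun k => V k (X, ω)) atTop (𝓝 (F X ω)) := by
    rw [tendsto_iff_edist_tendsto_0]
    simpa [edist_eq_enorm_sub] using h0
  have h2 : Tendsto (fun k => (V k (X, ω) : EReal)) atTop (𝓝 (F X ω : EReal)) :=
    (continuous_coe_real_ereal.tendsto _).comp h1
  rw [h2.limsup_eq, EReal.toReal_coe]

theorem isOpen_timeStrip (d : ℕ) (T : EReal) : IsOpen (timeStrip d T) :=
  (isOpen_lt continuous_const continuous_fst).inter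
    (isOpen_lt (continuous_coe_real_ereal.comp continuous_fst) continuous_const)

/-- The increment bound is locally uniform in x, which gives L²(Ω) continuity. For each fixed X the
version changes the integral only on a null set. -/
theorem exists_measurable_isStochConvolutionOn {d : ℕ} {K : ℝ → EuclideanSpace ℝ (Fin d) → ℝ}
    {T : EReal} {β : ℝ≥0} {γ₁ γ₂ : ℝ} {N₀ N₁ : ℝ≥0} {g : EuclideanSpace ℝ (Fin d) → ℝ}
    {Cg : ℝ≥0} {Ω : Type*} [MeasurableSpace Ω] {P : Measure Ω} [IsProbabilityMeasure P]
    {W : ℝ≥0 → Ω → ℝ} (hK : KernelConditions K T β γ₁ γ₂ N₀ N₁)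
    (hg : HolderWith Cg β g) (g0 : g 0 = 0) (hβ : 0 < β) (hβ1 : β ≤ 1)
    (hγ₁ : 0 < γ₁) (hγ₂ : 0 < γ₂) (hW : IsPreBrownianReal W P) :
    ∃ u : SpaceTime d → Ω → ℝ, Measurable (Function.uncurry u) ∧
      IsStochConvolutionOn P W K g (timeStrip d T) u := by
  have hex (X : SpaceTime d) : ∃ J : Lp ℝ 2 P, X ∈ timeStrip d T →
      IsWienerIntegral P W X.1.toNNReal (fun r => ∫ y, K (X.1 - r) y * g (X.2 - y)) J := by
    by_cases hX : X ∈ timeStrip d T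
    · have h := hK.memLp_convolution hg g0 hβ hβ1 hX.1 hX.2.le X.2
      rw [← Real.coe_toNNReal _ hX.1.le] at h
      obtain ⟨J, hJ⟩ := exists_isWienerIntegral hW h
      rw [Real.coe_toNNReal _ hX.1.le] at hJ
      exact ⟨J, fun _ => hJ⟩
    · exact ⟨0, fun h => absurd h hX⟩
  choose F hF using hex
  have hcont : ContinuousOn F (timeStrip d T) := by
    intro X hX
    rw [ContinuousWithinAt, tendsto_iff_edist_tendsto_0]
    set M : ℝ≥0 := ‖X.2‖₊ + 1
    have hmod : Tendsto (fun Y : SpaceTime d => eLpNorm id 2 (gaussianReal 0 1) *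
        (convolutionConst N₀ N₁ Cg M β * ENNReal.ofReal (convolutionModulus γ₁ γ₂ β Y X)))
        (𝓝[timeStrip d T] X) (𝓝 0) := by
      have hc : Continuous fun Y : SpaceTime d => convolutionModulus γ₁ γ₂ β Y X := by
        unfold convolutionModulus
        refine (Continuous.add ?_ ?_).add ?_
        · exact (continuous_fst.sub continuous_const).abs.rpow_const fun _ => Or.inr (by positivity)
        · exact (continuous_fst.sub continuous_const).abs.rpow_const fun _ => Or.inr (by positivity)
        · exact (continuous_snd.sub continuous_const).norm.rpow_const
            fun _ => Or.inr β.coe_nonneg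
      have h0 : convolutionModulus γ₁ γ₂ β X X = 0 := by
        simp [convolutionModulus, hγ₁.ne', hγ₂.ne', hβ.ne']
      have h1 := ((ENNReal.continuous_ofReal.comp hc).tendsto X).mono_left
        (nhdsWithin_le_nhds (s := timeStrip d T))
      simp only [Function.comp_apply, h0, ENNReal.ofReal_zero] at h1
      simpa using ENNReal.Tendsto.const_mul (ENNReal.Tendsto.const_mul h1
        (Or.inr (ENNReal.coe_ne_top (r := convolutionConst N₀ N₁ Cg M β))))
        (Or.inr (eLpNorm_id_gaussianReal_ne_top (q := 2) (by simp)))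
    refine tendsto_of_tendsto_of_tendsto_of_le_of_le' tendsto_const_nhds hmod
      (Eventually.of_forall fun _ => zero_le) ?_
    have hnear : ∀ᶠ Y : SpaceTime d in 𝓝[timeStrip d T] X, ‖Y.2‖ < M :=
      nhdsWithin_le_nhds ((continuous_snd.norm.tendsto X).eventually_lt_const (by simp [M]))
    filter_upwards [hnear, self_mem_nhdsWithin] with Y hYM hY
    rw [Lp.edist_def]
    exact IsStochConvolutionOn.eLpNorm_sub_le hK hg g0 hβ hβ1 hW (S := timeStrip d T) subset_rfl
      (u := fun X => F X) (fun Z hZ => hF Z hZ) hY hX hYM.le (by simp [M]) (by simp)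
  obtain ⟨u, hum, hu⟩ := exists_measurable_version (isOpen_timeStrip d T).measurableSet hcont
  exact ⟨u, hum, fun X hX => (hF X hX).congr_ae (hu X hX).symm⟩

/-! ### Parabolic geometry and scaling -/

theorem rpow_half_lt_iff {a ρ : ℝ} (hρ : 0 < ρ) :
    a ^ (1 / 2 : ℝ) < ρ ↔ a < ρ ^ 2 := by
  rw [← Real.sqrt_eq_rpow, Real.sqrt_lt' hρ]

theorem parabolicBall_eq_prod {d : ℕ} (X : SpaceTime d) {ρ : ℝ} (hρ : 0 < ρ) :
    parabolicBall X ρ = Metric.ball X.1 (ρ ^ 2) ×ˢ Metric.ball X.2 ρ := by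
  ext Y
  rw [parabolicBall, mem_ofPred_eq, parabolicDist, max_lt_iff, rpow_half_lt_iff hρ,
    mem_prod, Metric.mem_ball', Metric.mem_ball', Real.dist_eq, dist_eq_norm, and_comm]

theorem volume_parabolicBall {d : ℕ} (X : SpaceTime d) {ρ : ℝ} (hρ : 0 < ρ) :
    volume (parabolicBall X ρ) = ENNReal.ofReal ρ ^ ((d : ℝ) + 2) *
      (2 * volume (Metric.ball (0 : EuclideanSpace ℝ (Fin d)) 1)) := by
  rw [parabolicBall_eq_prod X hρ, Measure.volume_eq_prod, Measure.prod_prod, Real.volume_ball,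
    Measure.addHaar_ball_of_pos _ _ hρ, finrank_euclideanSpace, Fintype.card_fin,
    ENNReal.ofReal_mul (by norm_num), ENNReal.ofReal_pow hρ.le, ENNReal.ofReal_pow hρ.le,
    ENNReal.rpow_add _ _ (by simpa using hρ) (by simp)]
  simp only [ENNReal.rpow_natCast, ENNReal.rpow_ofNat, ENNReal.ofReal_ofNat]
  ring

theorem parabolicDiam_le {d : ℕ} {D : Set (SpaceTime d)} {R : ℝ≥0}
    (hD : D ⊆ Metric.closedBall 0 R) :
    parabolicDiam D ≤ ENNReal.ofReal (2 * R + (2 * R) ^ (1 / 2 : ℝ)) := by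
  refine iSup₂_le fun X hX => iSup₂_le fun Y hY => ENNReal.ofReal_le_ofReal ?_
  have hXY : ‖X - Y‖ ≤ 2 * R := by
    have h1 := mem_closedBall_zero_iff.1 (hD hX)
    have h2 := mem_closedBall_zero_iff.1 (hD hY)
    linarith [norm_sub_le X Y]
  have h1 : |X.1 - Y.1| ≤ 2 * R := (norm_fst_le (X - Y)).trans hXY
  have h2 : ‖X.2 - Y.2‖ ≤ 2 * R := (norm_snd_le (X - Y)).trans hXY
  have h3 : |X.1 - Y.1| ^ (1 / 2 : ℝ) ≤ (2 * R : ℝ) ^ (1 / 2 : ℝ) := by gcongr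
  have h4 : (0 : ℝ) ≤ (2 * R : ℝ) ^ (1 / 2 : ℝ) := by positivity
  have h5 : (0 : ℝ) ≤ 2 * R := by positivity
  exact max_le (by linarith) (by linarith)

/-- Absorbs the surplus exponent into the a priori bound M on the radius, so that the smallest
exponent governs. -/
theorem Real.rpow_le_mul_rpow_of_le {ρ M γ γ' : ℝ} (hρ : 0 < ρ) (hM : ρ ≤ M) (h : γ ≤ γ') :
    ρ ^ γ' ≤ M ^ (γ' - γ) * ρ ^ γ := by
  calc ρ ^ γ' = ρ ^ (γ' - γ) * ρ ^ γ := by rw [← Real.rpow_add hρ]; simp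
    _ ≤ _ := by
      gcongr

/-- Time differences are at most 2ρ² and space differences at most 2ρ, so halved time exponents
become full powers of ρ. -/
theorem convolutionModulus_le {d : ℕ} {γ₁ γ₂ β γ M ρ : ℝ} (hγ₁ : 0 < γ₁) (hγ₂ : 0 < γ₂)
    (hβ : 0 < β) (h₁ : γ ≤ γ₁) (h₂ : γ ≤ γ₂) (hγβ : γ ≤ β) (hρ : 0 < ρ) (hM : ρ ≤ M)
    {X Y Z : SpaceTime d} (hX : X ∈ parabolicBall Z ρ) (hY : Y ∈ parabolicBall Z ρ) :
    convolutionModulus γ₁ γ₂ β X Y ≤ (2 ^ (γ₁ / 2) * M ^ (γ₁ - γ) + 2 ^ (γ₂ / 2) * M ^ (γ₂ - γ) +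
      2 ^ β * M ^ (β - γ)) * ρ ^ γ := by
  rw [parabolicBall_eq_prod Z hρ, mem_prod, Metric.mem_ball, Metric.mem_ball] at hX hY
  have ht : |X.1 - Y.1| ≤ 2 * ρ ^ 2 := by
    rw [← Real.dist_eq]
    linarith [dist_triangle_right X.1 Y.1 Z.1, hX.1, hY.1]
  have hx : ‖X.2 - Y.2‖ ≤ 2 * ρ := by
    rw [← dist_eq_norm]
    linarith [dist_triangle_right X.2 Y.2 Z.2, hX.2, hY.2]
  have time {η : ℝ} (hη : 0 < η) (hle : γ ≤ η) :
      |X.1 - Y.1| ^ (η / 2) ≤ 2 ^ (η / 2) * M ^ (η - γ) * ρ ^ γ := by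
    calc |X.1 - Y.1| ^ (η / 2) ≤ (2 * ρ ^ 2) ^ (η / 2) := by gcongr
      _ = 2 ^ (η / 2) * ρ ^ η := by
        rw [Real.mul_rpow (by norm_num) (by positivity), ← Real.rpow_natCast ρ 2,
          ← Real.rpow_mul hρ.le]
        congr 2
        push_cast
        ring
      _ ≤ _ := by
        rw [mul_assoc]
        gcongr
        exact Real.rpow_le_mul_rpow_of_le hρ hM hle
  have space : ‖X.2 - Y.2‖ ^ β ≤ 2 ^ β * M ^ (β - γ) * ρ ^ γ := by
    calc ‖X.2 - Y.2‖ ^ β ≤ (2 * ρ) ^ β := by gcongr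
      _ = 2 ^ β * ρ ^ β := Real.mul_rpow (by norm_num) hρ.le
      _ ≤ _ := by
        rw [mul_assoc]
        gcongr
        exact Real.rpow_le_mul_rpow_of_le hρ hM hγβ
  unfold convolutionModulus
  rw [add_mul, add_mul]
  exact add_le_add (add_le_add (time hγ₁ h₁) (time hγ₂ h₂)) space

/-! ### The Campanato bound -/

/-- Tonelli, available through joint measurability, moves the expectation inside both space-time
integrals. -/
theorem expectedOscillation_le {d : ℕ} {Ω : Type*} [MeasurableSpace Ω] {P : Measure Ω}
    [SFinite P] {p : ℝ} {Q : Set (SpaceTime d)} (hQ : MeasurableSet Q)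
    {u : SpaceTime d → Ω → ℝ} (hu : Measurable (Function.uncurry u)) {B : ℝ≥0∞}
    (hB : ∀ Y ∈ Q, ∀ Z ∈ Q, ∫⁻ ω, ‖u Y ω - u Z ω‖ₑ ^ p ∂P ≤ B) :
    expectedOscillation P p Q u ≤ B * volume Q ^ 2 := by
  have hm : Measurable fun q : (Ω × SpaceTime d) × SpaceTime d =>
      ‖u q.1.2 q.1.1 - u q.2 q.1.1‖ₑ ^ p := by
    refine (Measurable.enorm (Measurable.sub ?_ ?_)).pow_const p
    · exact hu.comp ((measurable_snd.comp measurable_fst).prodMk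
        (measurable_fst.comp measurable_fst))
    · exact hu.comp (measurable_snd.prodMk (measurable_fst.comp measurable_fst))
  unfold expectedOscillation
  rw [lintegral_lintegral_swap (Measurable.lintegral_prod_right' hm).aemeasurable]
  have hswap (Y) : ∫⁻ ω, ∫⁻ Z in Q, ‖u Y ω - u Z ω‖ₑ ^ p ∂volume ∂P =
      ∫⁻ Z in Q, ∫⁻ ω, ‖u Y ω - u Z ω‖ₑ ^ p ∂P ∂volume :=
    lintegral_lintegral_swap (hm.comp ((measurable_fst.prodMk measurable_const).prodMk
      measurable_snd)).aemeasurable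
  simp_rw [hswap]
  calc _ ≤ ∫⁻ _ in Q, ∫⁻ _ in Q, B :=
        setLIntegral_mono' hQ fun Y hY => setLIntegral_mono' hQ fun Z hZ => hB Y hY Z hZ
    _ = _ := by simp [sq, mul_assoc]

theorem lintegral_enorm_rpow_eq_eLpNorm_rpow {Ω : Type*} [MeasurableSpace Ω] {P : Measure Ω}
    {p : ℝ} (hp : 0 < p) (f : Ω → ℝ) :
    ∫⁻ ω, ‖f ω‖ₑ ^ p ∂P = eLpNorm f (ENNReal.ofReal p) P ^ p := by
  rw [eLpNorm_eq_lintegral_rpow_enorm_toReal (by simpa using hp) (by simp),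
    ENNReal.toReal_ofReal hp.le, ← ENNReal.rpow_mul, one_div, inv_mul_cancel₀ hp.ne',
    ENNReal.rpow_one]

/-- Scaling step: a bound of order `ρ^γ` for the `L^p` increments in `Q`, and the `A`-type lower
bound for `|Q|`, give a bound for the Campanato quotient. -/
theorem div_volume_rpow_le {E m a C r : ℝ≥0∞} {p γ k : ℝ} (hp : 0 < p) (hγ : 0 ≤ γ) (hk : 0 < k)
    (hm0 : m ≠ 0) (hm : m ≠ ∞) (ha0 : a ≠ 0) (ha : a ≠ ∞) (hE : E ≤ (C * r ^ γ) ^ p * m ^ 2)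
    (hlow : r ^ k * a ≤ m) :
    E / m ^ (1 + (1 + γ * p / k)) ≤ C ^ p / a ^ (γ * p / k) := by
  have he : 0 ≤ γ * p / k := by positivity
  have ha0' : a ^ (γ * p / k) ≠ 0 := by simp [ENNReal.rpow_eq_zero_iff, ha0, ha]
  have ha' : a ^ (γ * p / k) ≠ ∞ := ENNReal.rpow_ne_top_of_nonneg he ha
  refine ENNReal.div_le_of_le_mul (hE.trans ?_)
  calc (C * r ^ γ) ^ p * m ^ 2 = C ^ p * r ^ (γ * p) * m ^ 2 := by
        rw [ENNReal.mul_rpow_of_nonneg _ _ hp.le, ← ENNReal.rpow_mul]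
    _ = C ^ p / a ^ (γ * p / k) * ((r ^ k * a) ^ (γ * p / k) * m ^ 2) := by
        rw [ENNReal.mul_rpow_of_nonneg _ _ he, ← ENNReal.rpow_mul, mul_div_cancel₀ _ hk.ne',
          mul_comm (r ^ (γ * p)), mul_assoc (a ^ _), ← mul_assoc (C ^ p / _),
          ENNReal.div_mul_cancel ha0' ha', mul_assoc]
    _ ≤ C ^ p / a ^ (γ * p / k) * (m ^ (γ * p / k) * m ^ 2) := by gcongr
    _ = C ^ p / a ^ (γ * p / k) * m ^ (1 + (1 + γ * p / k)) := by
        congr 1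
        rw [← ENNReal.rpow_natCast, ← ENNReal.rpow_add _ _ hm0 hm]
        congr 1
        push_cast
        ring

theorem theorem2p2 (d : ℕ) (T : EReal) (hT : 0 < T) (p : ℝ) (hp : 1 ≤ p)
    (β : ℝ≥0) (hβ : 0 < β) (hβ1 : β < 1) (γ₁ γ₂ : ℝ) (hγ₁ : 0 < γ₁) (hγ₂ : 0 < γ₂)
    (N₀ N₁ Cg A R : ℝ≥0) (hA : 0 < A) :
    ∃ N : ℝ≥0,
      ∀ (K : ℝ → EuclideanSpace ℝ (Fin d) → ℝ), KernelConditions K T β γ₁ γ₂ N₀ N₁ →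
      ∀ (g : EuclideanSpace ℝ (Fin d) → ℝ), HolderWith Cg β g → g 0 = 0 →
      ∀ (Ω : Type*) [MeasurableSpace Ω] (P : Measure Ω) [IsProbabilityMeasure P]
        (W : ℝ≥0 → Ω → ℝ), IsBrownianReal W P →
      (∃ u : SpaceTime d → Ω → ℝ, Measurable (Function.uncurry u) ∧
        IsStochConvolutionOn P W K g (timeStrip d T) u) ∧
      ∀ (D : Set (SpaceTime d)), IsOpen D → IsConnected D →
        closure D ⊆ timeStrip d T → D ⊆ Metric.closedBall 0 R → IsATypeWith A D →
      ∀ u : SpaceTime d → Ω → ℝ, Measurable (Function.uncurry u) →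
        IsStochConvolutionOn P W K g D u →
        stochCampanatoSeminorm P p (1 + min (min γ₁ γ₂) (β : ℝ) * p / ((d : ℝ) + 2)) D u ≤ N := by
  have hp0 : 0 < p := zero_lt_one.trans_le hp
  have hβ' : (0 : ℝ) < β := hβ
  set γ := min (min γ₁ γ₂) (β : ℝ)
  have hγ : 0 < γ := lt_min (lt_min hγ₁ hγ₂) hβ'
  have hle₁ : γ ≤ γ₁ := (min_le_left _ _).trans (min_le_left _ _)
  have hle₂ : γ ≤ γ₂ := (min_le_left _ _).trans (min_le_right _ _)
  have hleβ : γ ≤ β := min_le_right _ _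
  -- Bounds the parabolic diameter of any D in the ball of radius R; the sum dominates the maximum
  -- in the distance.
  let M : ℝ := 2 * R + (2 * R : ℝ) ^ (1 / 2 : ℝ)
  have hM0 : 0 ≤ M := by positivity
  let C : ℝ := 2 ^ (γ₁ / 2) * M ^ (γ₁ - γ) + 2 ^ (γ₂ / 2) * M ^ (γ₂ - γ) + 2 ^ (β : ℝ) * M ^ (β - γ)
  have hC0 : 0 ≤ C := by positivity
  let G : ℝ≥0∞ := eLpNorm id (ENNReal.ofReal p) (gaussianReal 0 1)
  have hG : G ≠ ∞ := eLpNorm_id_gaussianReal_ne_top (by simp)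
  let B : ℝ≥0∞ := G * (convolutionConst N₀ N₁ Cg R β * ENNReal.ofReal C)
  have hB : B ≠ ∞ := by finiteness
  -- The A-type condition reads ρ^(d+2) · `a` ≤ |Q|.
  let a : ℝ≥0∞ := A * (2 * volume (Metric.ball (0 : EuclideanSpace ℝ (Fin d)) 1))
  have hball0 : volume (Metric.ball (0 : EuclideanSpace ℝ (Fin d)) 1) ≠ 0 :=
    (Metric.measure_ball_pos _ _ one_pos).ne'
  have hballtop : volume (Metric.ball (0 : EuclideanSpace ℝ (Fin d)) 1) ≠ ∞ :=
    measure_ball_lt_top.ne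
  have ha0 : a ≠ 0 := by simp [a, hA.ne', hball0]
  have ha : a ≠ ∞ := by finiteness
  have he : 0 ≤ γ * p / ((d : ℝ) + 2) := by positivity
  let L : ℝ≥0∞ := B ^ p / a ^ (γ * p / ((d : ℝ) + 2))
  have hL : L ≠ ∞ := ENNReal.div_ne_top (ENNReal.rpow_ne_top_of_nonneg hp0.le hB)
    (by simp [ENNReal.rpow_eq_zero_iff, ha0, ha])
  refine ⟨(L ^ (1 / p)).toNNReal, fun K hK g hg g0 Ω _ P _ W hW =>
    ⟨exists_measurable_isStochConvolutionOn hK hg g0 hβ hβ1.le hγ₁ hγ₂ hW.toIsPreBrownianReal,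
      fun D hDo _ hDT hDR hDA u hum hu => ?_⟩⟩
  rw [ENNReal.coe_toNNReal (ENNReal.rpow_ne_top_of_nonneg (by positivity) hL)]
  unfold stochCampanatoSeminorm
  gcongr
  refine iSup₂_le fun X hX => iSup_le fun ρ => iSup_le fun hρ => ?_
  have hρ0 := hρ.1
  have hρM : ρ ≤ M := (ENNReal.ofReal_le_ofReal_iff hM0).1 (hρ.2.trans (parabolicDiam_le hDR))
  have hQm : MeasurableSet (D ∩ parabolicBall X ρ) := by
    rw [parabolicBall_eq_prod X hρ0]
    exact hDo.measurableSet.inter (Metric.isOpen_ball.prod Metric.isOpen_ball).measurableSet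
  have hlow : ENNReal.ofReal ρ ^ ((d : ℝ) + 2) * a ≤ volume (D ∩ parabolicBall X ρ) := by
    refine le_trans (le_of_eq ?_) (hDA X hX ρ hρ0 hρ.2)
    rw [volume_parabolicBall X hρ0, mul_left_comm]
  have hQ0 : volume (D ∩ parabolicBall X ρ) ≠ 0 := by
    refine ne_of_gt (lt_of_lt_of_le (pos_iff_ne_zero.2 (mul_ne_zero ?_ ha0)) hlow)
    simp [ENNReal.rpow_eq_zero_iff, hρ0]
  have hQtop : volume (D ∩ parabolicBall X ρ) ≠ ∞ := by
    refine ne_top_of_le_ne_top ?_ (measure_mono inter_subset_right)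
    rw [volume_parabolicBall X hρ0]
    finiteness
  refine div_volume_rpow_le hp0 hγ.le (by positivity) hQ0 hQtop ha0 ha ?_ hlow
  refine expectedOscillation_le hQm hum fun Y hY Z hZ => ?_
  rw [lintegral_enorm_rpow_eq_eLpNorm_rpow hp0]
  gcongr
  have hnorm {V : SpaceTime d} (hV : V ∈ D) : ‖V.2‖ ≤ R :=
    (norm_snd_le V).trans (mem_closedBall_zero_iff.1 (hDR hV))
  refine (IsStochConvolutionOn.eLpNorm_sub_le hK hg g0 hβ hβ1.le hW.toIsPreBrownianReal
    (subset_closure.trans hDT) hu hY.1 hZ.1 (hnorm hY.1) (hnorm hZ.1) (by simp)).trans ?_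
  have hmod := convolutionModulus_le hγ₁ hγ₂ hβ' hle₁ hle₂ hleβ hρ0 hρM hY.2 hZ.2
  calc G * (convolutionConst N₀ N₁ Cg R β * ENNReal.ofReal (convolutionModulus γ₁ γ₂ β Y Z))
      ≤ G * (convolutionConst N₀ N₁ Cg R β * ENNReal.ofReal (C * ρ ^ γ)) := by gcongr
    _ = B * ENNReal.ofReal ρ ^ γ := by
      rw [ENNReal.ofReal_mul hC0, ← ENNReal.ofReal_rpow_of_nonneg hρ0.le hγ.le]
      simp only [B, mul_assoc]
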